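/- **DAG treedepth.** Let $\vec H$ be a finite directed acyclic graph (DAG). A *source* is a vertex of indegree $0$. A *DAG elimination forest* of $\vec H$ is defined recursively: if $\vec H$ is empty, the forest is empty; if the underlying undirected graph of $\vec H$ is disconnected, the forest is the union of DAG elimination forests of the connected components; if it is connected, choose a source $s$, delete $s$ and all vertices reachable from $s$, and take the tree with root $s$ whose subtrees are the trees of a DAG elimination forest of the remaining DAG (a single node, if nothing remains). The *depth* of a forest is the largest number of nodes on a root-to-leaf path, and the *DAG treedepth* $\operatorname{dtd}(\vec H)$ is the minimum depth of a DAG elimination forest of $\vec H$. **Counting problem and model.** A graph $G$ is *$d$-degenerate* if every nonempty subgraph of $G$ has a vertex of degree at most $d$. Equivalently, a finite $G$ has an acyclic orientation in which all outdegrees are at most $d$. For graphs $H$ and $G$, let $\mathrm{ind}(H,G)$ be the number of vertex sets $S\subseteq V(G)$ with $G[S]\cong H$. Algorithms run on a unit-cost RAM. The $n$-vertex host graph is stored in read-only input memory as the out-neighbour lists (in arbitrary order) of an arbitrary acyclic orientation of $G$ with outdegrees at most $d$, on arbitrarily numbered vertices; reading $n$, the outdegree of a vertex, or one entry of an out-neighbour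 list takes one step, as does every arithmetic operation ($+$, truncated $-$, $\cdot$, division with remainder), copy, constant assignment and test of a register against $0$. *Constant space* means that the working memory consists of a fixed number of registers, independent of $n$ and $G$, each holding a nonnegative integer bounded by a fixed polynomial in $n$ (a word of $O(\log n)$ bits). **Theorem.** 1. Every DAG $\vec H$ on at most nine vertices satisfies $\operatorname{dtd}(\vec H)\le 3$. 2. Let $d\ge 0$ be a constant and let $H$ be a graph on at most nine vertices. There are a program using a fixed number of registers, and constants $C,w$, all depending only on $d$ and $H$, such that for every $n$ and every $d$-degenerate graph $G$ on $n$ vertices: $G$ has an input representation as above, and on each such representation the program halts after at most $C(n^3+1)$ steps, never writes a value larger than $C(n+1)^w$ to a register, and outputs $\mathrm{ind}(H,G)$. That is, $\mathrm{ind}(H,G)$ is computed in $O(n^3)$ time and constant space. -/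

import Mathlib

/-! ### DAG treedepth -/

namespace Digraph

variable {V : Type*}

/-- A directed acyclic graph: there is no closed directed walk (hence no loop and no pair of
opposite edges). -/
def IsDAG (D : Digraph V) : Prop := ∀ v, ¬ Relation.TransGen D.Adj v v

/-- `s` is a source (a vertex of indegree zero) of the sub-DAG of `D` induced by `A`. -/
def IsSourceIn (D : Digraph V) (A : Set V) (s : V) : Prop :=
  s ∈ A ∧ ∀ u ∈ A, ¬ D.Adj u s

/-- The vertex `s` together with all vertices reachable from `s` in the sub-DAG of `D` induced
by `A`. -/
def reachIn (D : Digraph V) (A : Set V) (s : V) : Set V :=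
  {v | Relation.ReflTransGen (fun x y => x ∈ A ∧ y ∈ A ∧ D.Adj x y) s v}

/-- The underlying undirected graph of the sub-DAG of `D` induced by `A`. -/
def underlyingOn (D : Digraph V) (A : Set V) : SimpleGraph A :=
  D.toSimpleGraphInclusive.induce A

/-- The DAG elimination forests of the sub-DAG of `D` induced by `A`.

* If `A` is empty, the forest is empty.
* If `A` is disconnected, the forest is a union of elimination forests, one for each connected
  component.
* If `A` is connected, a source `s` is chosen; it is the root of a tree whose subtrees are the
  trees of an elimination forest of what remains after `s` and all vertices reachable from `s`
  are deleted. (When `s` is the only source nothing remains, and the tree is a single node.) -/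
inductive ElimForest (D : Digraph V) : Set V → Type _
  | empty (A : Set V) (hA : A = ∅) : ElimForest D A
  | union (A : Set V) (hne : A.Nonempty) (hA : ¬ (D.underlyingOn A).Connected)
      (F : ∀ c : (D.underlyingOn A).ConnectedComponent, ElimForest D (Subtype.val '' c.supp)) :
      ElimForest D A
  | root (A : Set V) (hA : (D.underlyingOn A).Connected) (s : V) (hs : D.IsSourceIn A s)
      (F : ElimForest D (A \ D.reachIn A s)) : ElimForest D A

/-- The depth of an elimination forest: the largest number of nodes on a path from a root to a
leaf. -/
noncomputable def ElimForest.depth {D : Digraph V} : {A : Set V} → D.ElimForest A → ℕ∞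
  | _, .empty _ _ => 0
  | _, .union _ _ _ F => ⨆ c, (F c).depth
  | _, .root _ _ _ _ F => F.depth + 1

/-- The DAG treedepth: the minimum depth of a DAG elimination forest (`⊤` if there is none). -/
noncomputable def dagTreedepth (D : Digraph V) : ℕ∞ :=
  ⨅ F : D.ElimForest Set.univ, F.depth

end Digraph

/-! ### Degenerate host graphs and induced subgraph counts -/

/-- A graph is `d`-degenerate if every nonempty subgraph has a vertex of degree at most `d`. -/
def SimpleGraph.IsDegenerate {V : Type*} (G : SimpleGraph V) (d : ℕ) : Prop :=
  ∀ K : G.Subgraph, K.verts.Nonempty → ∃ v ∈ K.verts, (K.neighborSet v).encard ≤ d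

/-- The number of induced subgraphs `G[S]` of `G` that are isomorphic to `H`. -/
noncomputable def indCount {W V : Type*} (H : SimpleGraph W) (G : SimpleGraph V) : ℕ :=
  {S : Set V | Nonempty (G.induce S ≃g H)}.ncard

/-- The representation of a `d`-degenerate graph `G` on the vertices `0, …, n - 1` as the input of
an algorithm: for each vertex, the list (in an arbitrary order) of its out-neighbours in some
acyclic orientation of `G` in which all outdegrees are at most `d`. -/
structure HostInput {n : ℕ} (G : SimpleGraph (Fin n)) (d : ℕ) where
  out : Fin n → List (Fin n)
  nodup : ∀ v, (out v).Nodup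
  length_le : ∀ v, (out v).length ≤ d
  adj_iff : ∀ u v, G.Adj u v ↔ v ∈ out u ∨ u ∈ out v
  acyclic : ∀ v, ¬ Relation.TransGen (fun x y => y ∈ out x) v v

namespace HostInput

variable {n d : ℕ} {G : SimpleGraph (Fin n)}

/-- The outdegree of vertex number `v`; `0` if there is no such vertex. -/
def outdegree (I : HostInput G d) (v : ℕ) : ℕ :=
  if h : v < n then (I.out ⟨v, h⟩).length else 0

/-- Entry number `i` (counted from `0`) of the out-neighbour list of vertex number `v`; `0` if
there is no such entry. -/
def outNeighbour (I : HostInput G d) (v i : ℕ) : ℕ :=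
  if h : v < n then ((I.out ⟨v, h⟩)[i]?.map Fin.val).getD 0 else 0

end HostInput

/-! ### A unit-cost RAM with read-only input and a fixed number of working registers -/

namespace RAM

/-- The right-hand sides of assignments; `ρ` is the set of registers. -/
inductive Op (ρ : Type)
  | const (a : ℕ)
  | copy (x : ρ)
  | add (x y : ρ)
  | sub (x y : ρ)
  | mul (x y : ρ)
  | div (x y : ρ)
  | size
  | outdegree (x : ρ)
  | outNeighbour (x y : ρ)

/-- Programs over the set of registers `ρ`. -/
inductive Prog (ρ : Type)
  | skip
  | assign (x : ρ) (e : Op ρ)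
  | seq (p q : Prog ρ)
  | ifNZ (x : ρ) (p q : Prog ρ)
  | whileNZ (x : ρ) (p : Prog ρ)

variable {ρ : Type} {n d : ℕ} {G : SimpleGraph (Fin n)}

/-- The value of a right-hand side, for register contents `σ` and the input `I`. The subtraction
of natural numbers is truncated, and division is division with remainder. -/
def Op.eval (I : HostInput G d) (σ : ρ → ℕ) : Op ρ → ℕ
  | .const a => a
  | .copy x => σ x
  | .add x y => σ x + σ y
  | .sub x y => σ x - σ y
  | .mul x y => σ x * σ y
  | .div x y => σ x / σ y
  | .size => n
  | .outdegree x => I.outdegree (σ x)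
  | .outNeighbour x y => I.outNeighbour (σ x) (σ y)

/-- `Exec I B p σ t τ`: on input `I`, the program `p`, started with register contents `σ`, halts
after exactly `t` steps with register contents `τ`, and no value that is ever written to a
register exceeds `B`. Every assignment and every test of a register takes one step; an
assignment of a value that exceeds `B` is not possible. -/
inductive Exec [DecidableEq ρ] (I : HostInput G d) (B : ℕ) :
    Prog ρ → (ρ → ℕ) → ℕ → (ρ → ℕ) → Prop
  | skip (σ : ρ → ℕ) : Exec I B .skip σ 1 σ
  | assign (x : ρ) (e : Op ρ) (σ : ρ → ℕ) (h : e.eval I σ ≤ B) :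
      Exec I B (.assign x e) σ 1 (Function.update σ x (e.eval I σ))
  | seq {p q : Prog ρ} {σ τ υ : ρ → ℕ} {s t : ℕ} (hp : Exec I B p σ s τ)
      (hq : Exec I B q τ t υ) : Exec I B (.seq p q) σ (s + t) υ
  | if_true {x : ρ} {p q : Prog ρ} {σ τ : ρ → ℕ} {t : ℕ} (hx : σ x ≠ 0)
      (hp : Exec I B p σ t τ) : Exec I B (.ifNZ x p q) σ (t + 1) τ
  | if_false {x : ρ} {p q : Prog ρ} {σ τ : ρ → ℕ} {t : ℕ} (hx : σ x = 0)
      (hq : Exec I B q σ t τ) : Exec I B (.ifNZ x p q) σ (t + 1) τ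
  | while_true {x : ρ} {p : Prog ρ} {σ τ υ : ρ → ℕ} {s t : ℕ} (hx : σ x ≠ 0)
      (hp : Exec I B p σ s τ) (hw : Exec I B (.whileNZ x p) τ t υ) :
      Exec I B (.whileNZ x p) σ (s + t + 1) υ
  | while_false {x : ρ} {p : Prog ρ} {σ : ρ → ℕ} (hx : σ x = 0) :
      Exec I B (.whileNZ x p) σ 1 σ

end RAM

/-! Treedepth: call a vertex shared if at least two sources reach it. Each root removes a source, so
at most three sources give depth at most three (`IsDAG.depthLE_of_ncard_sources`). If there are `p ≥
4` sources and `x` shared vertices, then `p + x ≤ 9`, and double counting the pairs (source, shared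
vertex it reaches) yields a source that misses at most two shared vertices
(`exists_source_ncard_le_two`). Removing its reach leaves at most two shared vertices, and these
cost depth at most two (`IsDAG.depthLE_two`).

Counting: write the indicator of an induced embedding as a product over pairs of pattern vertices,
and expand each factor into the relations `x → y`, `y → x`, `x = y` and "no condition". The number
of embeddings becomes an integer combination of homomorphism counts of digraphs on at most nine
vertices into the oriented host (`card_embedding_expansion`); the non-acyclic ones contribute zero.
For an acyclic one, an elimination forest organises the count (`expressible_of_elimForest`):
components multiply, the image of a root ranges over all `n` vertices, and the images of the
vertices reachable from it range over at most `d` out-neighbours each. Nested sums over all vertices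
therefore number at most the depth, which is three. Such a nested formula is evaluated by nested
loops without any table, hence in cubic time with a fixed set of registers (`Expr.exists_prog`).
Dividing by the number of automorphisms gives the induced subgraph count. -/

namespace Digraph

open Relation

variable {V : Type*} {D : Digraph V}

/-! ### DAG treedepth: sources and shared vertices. -/

/-- No edge of `D` enters `A` from outside. -/
def InClosed (D : Digraph V) (A : Set V) : Prop :=
  ∀ ⦃u v⦄, D.Adj u v → v ∈ A → u ∈ A

/-- `s` is a source of the whole digraph. -/
def IsSource (D : Digraph V) (s : V) : Prop := ∀ u, ¬ D.Adj u s

/-- `v` is reachable from at least two sources. -/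
def IsShared (D : Digraph V) (v : V) : Prop :=
  ∃ s t, s ≠ t ∧ D.IsSource s ∧ D.IsSource t ∧
    ReflTransGen D.Adj s v ∧ ReflTransGen D.Adj t v

/-- A recursive form of "there is an elimination forest of `A` of depth at most `l`". -/
def DepthLE (D : Digraph V) : ℕ → Set V → Prop
  | 0, A => A = ∅
  | l + 1, A => ∀ C ⊆ A, (D.underlyingOn C).Connected →
      (∀ u ∈ C, ∀ v ∈ A, D.Adj u v ∨ D.Adj v u → v ∈ C) →
      ∃ s, D.IsSourceIn C s ∧ DepthLE D l (C \ D.reachIn C s)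

theorem underlyingOn_adj {A : Set V} {u v : A} :
    (D.underlyingOn A).Adj u v ↔ u ≠ v ∧ (D.Adj u v ∨ D.Adj v u) := by
  simp [underlyingOn, toSimpleGraphInclusive, SimpleGraph.fromRel_adj, Subtype.ext_iff]

theorem image_supp_closed {A : Set V} (c : (D.underlyingOn A).ConnectedComponent) :
    ∀ u ∈ Subtype.val '' c.supp, ∀ v ∈ A, D.Adj u v ∨ D.Adj v u →
      v ∈ Subtype.val '' c.supp := by
  rintro _ ⟨u, hu, rfl⟩ v hv h
  by_cases huv : (u : V) = v
  · exact ⟨u, hu, huv⟩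
  · refine ⟨⟨v, hv⟩, ?_, rfl⟩
    have hadj : (D.underlyingOn A).Adj u ⟨v, hv⟩ :=
      underlyingOn_adj.2 ⟨fun e => huv (congrArg Subtype.val e), h⟩
    exact (c.mem_supp_congr_adj hadj).1 hu

theorem connected_image_supp {A : Set V} (c : (D.underlyingOn A).ConnectedComponent) :
    (D.underlyingOn (Subtype.val '' c.supp)).Connected := by
  have h := c.connected_toSimpleGraph
  refine h.map (H := D.underlyingOn (Subtype.val '' c.supp))
    ⟨fun x => ⟨x.1.1, x.1, x.2, rfl⟩, ?_⟩ ?_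
  · intro a b hab
    have hab' : (D.underlyingOn A).Adj a.1 b.1 := hab
    rw [underlyingOn_adj] at hab' ⊢
    exact ⟨fun e => hab'.1 (Subtype.ext (congrArg (fun x => x.1) e)), hab'.2⟩
  · rintro ⟨_, x, hx, rfl⟩
    exact ⟨⟨x, hx⟩, rfl⟩

/-- The connected components of `A` are among the sets `C` over which `DepthLE` quantifies, so each
of them receives a root. -/
theorem DepthLE.exists_elimForest {l : ℕ} {A : Set V} (h : D.DepthLE l A) :
    ∃ F : D.ElimForest A, F.depth ≤ l := by
  induction l generalizing A with
  | zero => exact ⟨.empty A h, by simp [ElimForest.depth]⟩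
  | succ l ih =>
    have key : ∀ C ⊆ A, (D.underlyingOn C).Connected →
        (∀ u ∈ C, ∀ v ∈ A, D.Adj u v ∨ D.Adj v u → v ∈ C) →
        ∃ F : D.ElimForest C, F.depth ≤ (l + 1 : ℕ) := by
      intro C hCA hC hcl
      obtain ⟨s, hs, hl⟩ := h C hCA hC hcl
      obtain ⟨F, hF⟩ := ih hl
      refine ⟨.root C hC s hs F, ?_⟩
      simp only [ElimForest.depth, Nat.cast_add, Nat.cast_one]
      gcongr
    by_cases hA : (D.underlyingOn A).Connected
    · exact key A subset_rfl hA fun _ _ _ hv _ => hv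
    rcases A.eq_empty_or_nonempty with h0 | hne
    · exact ⟨.empty A h0, by simp [ElimForest.depth]⟩
    choose F hF using fun c : (D.underlyingOn A).ConnectedComponent =>
      key _ (Subtype.coe_image_subset _ _) (connected_image_supp c) (image_supp_closed c)
    refine ⟨.union A hne hA F, ?_⟩
    simpa only [ElimForest.depth] using iSup_le hF

theorem subset_of_connected {C R : Set V} (hC : (D.underlyingOn C).Connected) {a : V}
    (haC : a ∈ C) (haR : a ∈ R)
    (hR : ∀ u ∈ C, ∀ v ∈ C, u ∈ R → D.Adj u v ∨ D.Adj v u → v ∈ R) : C ⊆ R := by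
  intro b hb
  obtain ⟨p⟩ := hC.preconnected ⟨a, haC⟩ ⟨b, hb⟩
  have : ∀ {x y : C}, (D.underlyingOn C).Walk x y → x.1 ∈ R → y.1 ∈ R := by
    intro x y p
    induction p with
    | nil => exact id
    | cons h _ ih => exact fun hx => ih (hR _ (Subtype.prop _) _ (Subtype.prop _) hx
        (underlyingOn_adj.1 h).2)
  exact this p haR

theorem InClosed.mem_of_reaches {A : Set V} (hA : D.InClosed A) {u v : V}
    (h : ReflTransGen D.Adj u v) (hv : v ∈ A) : u ∈ A := by
  induction h using ReflTransGen.head_induction_on with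
  | refl => exact hv
  | head h _ ih => exact hA h ih

/-- A path ending in an in-closed set never leaves it. Since elimination preserves in-closedness,
sources and reachability can be measured in the whole of `D` throughout. -/
theorem InClosed.mem_reachIn {A : Set V} (hA : D.InClosed A) {u v : V} (hv : v ∈ A)
    (h : ReflTransGen D.Adj u v) : v ∈ D.reachIn A u := by
  induction h with
  | refl => exact .refl
  | tail _ h ih => exact .tail (ih (hA h hv)) ⟨hA h hv, hv, h⟩

theorem InClosed.inter_closed {A C : Set V} (hA : D.InClosed A) (hCA : C ⊆ A)
    (hcl : ∀ u ∈ C, ∀ v ∈ A, D.Adj u v ∨ D.Adj v u → v ∈ C) : D.InClosed C :=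
  fun _ _ huv hv => hcl _ hv _ (hA huv (hCA hv)) (.inr huv)

theorem InClosed.diff_reachIn {A : Set V} (hA : D.InClosed A) (s : V) :
    D.InClosed (A \ D.reachIn A s) := fun _ _ huv hv =>
  ⟨hA huv hv.1, fun hu => hv.2 (.tail hu ⟨hA huv hv.1, hv.1, huv⟩)⟩

theorem InClosed.depthLE_succ {A : Set V} (hA : D.InClosed A) {l : ℕ}
    (h : ∀ C ⊆ A, D.InClosed C → (D.underlyingOn C).Connected →
      (∀ u ∈ C, ∀ v ∈ A, D.Adj u v ∨ D.Adj v u → v ∈ C) →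
      ∃ s ∈ C, D.IsSource s ∧ ∀ B ⊆ C, D.InClosed B →
        (∀ v ∈ B, ¬ ReflTransGen D.Adj s v) → D.DepthLE l B) : D.DepthLE (l + 1) A := by
  intro C hCA hC hcl
  have hCi := hA.inter_closed hCA hcl
  obtain ⟨s, hsC, hs, hB⟩ := h C hCA hCi hC hcl
  exact ⟨s, ⟨hsC, fun u _ => hs u⟩, hB _ Set.sdiff_subset (hCi.diff_reachIn s)
    fun v hv hsv => hv.2 (hCi.mem_reachIn hv.1 hsv)⟩

theorem IsSource.not_isShared {s : V} (hs : D.IsSource s) : ¬ D.IsShared s := by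
  have : ∀ t, ReflTransGen D.Adj t s → t = s := fun t h => by
    rcases h.cases_tail with h | ⟨c, _, hc⟩
    · exact h.symm
    · exact (hs c hc).elim
  rintro ⟨t, t', hne, -, -, h, h'⟩
  exact hne ((this t h).trans (this t' h').symm)

variable [Finite V]

theorem IsDAG.exists_source (hD : D.IsDAG) (v : V) :
    ∃ s, D.IsSource s ∧ ReflTransGen D.Adj s v := by
  have : Std.Irrefl (TransGen D.Adj) := ⟨hD⟩
  have wf : WellFounded (TransGen D.Adj) := Finite.wellFounded_of_trans_of_irrefl _
  induction v using wf.induction with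
  | _ v ih =>
    by_cases hv : D.IsSource v
    · exact ⟨v, hv, .refl⟩
    · simp only [IsSource, not_forall, not_not] at hv
      obtain ⟨u, hu⟩ := hv
      obtain ⟨s, hs, hsu⟩ := ih u (.single hu)
      exact ⟨s, hs, hsu.tail hu⟩

/-- Each root is itself a source that disappears, and an in-closed set without sources is empty. -/
theorem IsDAG.depthLE_of_ncard_sources (hD : D.IsDAG) (l : ℕ) {A : Set V} (hA : D.InClosed A)
    (h : {s ∈ A | D.IsSource s}.ncard ≤ l) : D.DepthLE l A := by
  induction l generalizing A with
  | zero =>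
    rw [Nat.le_zero, Set.ncard_eq_zero (Set.toFinite _)] at h
    refine Set.eq_empty_of_forall_notMem fun v hv => ?_
    obtain ⟨s, hs, hsv⟩ := hD.exists_source v
    exact Set.notMem_empty s (h ▸ ⟨hA.mem_of_reaches hsv hv, hs⟩)
  | succ l ih =>
    refine hA.depthLE_succ fun C hCA hCi hC _ => ?_
    obtain ⟨v, hv⟩ := hC.nonempty
    obtain ⟨s, hs, hsv⟩ := hD.exists_source v
    have hsC := hCi.mem_of_reaches hsv hv
    refine ⟨s, hsC, hs, fun B hB hBi hBs => ih hBi ?_⟩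
    refine Nat.le_of_lt_succ (lt_of_lt_of_le (Set.ncard_lt_ncard ?_ (Set.toFinite _)) h)
    refine ⟨fun x hx => ⟨hCA (hB hx.1), hx.2⟩, fun hsub => ?_⟩
    exact hBs s (hsub ⟨hCA hsC, hs⟩).1 .refl

/-- The reach of a source `s` is closed under adjacency: if `w → u` and `s` reaches `u`, a source
above `w` also reaches `u`, so it equals `s` because `u` is not shared. Hence `s` reaches its whole
component. -/
theorem IsDAG.depthLE_one (hD : D.IsDAG) {A : Set V} (hA : D.InClosed A)
    (h : ∀ v ∈ A, ¬ D.IsShared v) : D.DepthLE 1 A := by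
  refine hA.depthLE_succ fun C hCA hCi hC _ => ?_
  obtain ⟨v, hv⟩ := hC.nonempty
  obtain ⟨s, hs, hsv⟩ := hD.exists_source v
  have hsC := hCi.mem_of_reaches hsv hv
  refine ⟨s, hsC, hs, fun B hB _ hBs => Set.eq_empty_of_forall_notMem fun x hx => hBs x hx ?_⟩
  refine subset_of_connected (R := {x | ReflTransGen D.Adj s x}) hC hsC .refl ?_ (hB hx)
  rintro u hu w hw hsu (huw | hwu)
  · exact ReflTransGen.tail hsu huw
  · obtain ⟨t, ht, htw⟩ := hD.exists_source w
    rcases eq_or_ne s t with rfl | hst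
    · exact htw
    · exact absurd ⟨s, t, hst, hs, ht, hsu, htw.tail hwu⟩ (h u (hCA hu))

/-- It suffices that each component has a source reaching all its shared vertices, as
`IsDAG.depthLE_one` handles the rest. Only the case where `a` and `b` are both shared and in the
component needs connectedness. -/
theorem IsDAG.depthLE_two (hD : D.IsDAG) {A : Set V} (hA : D.InClosed A)
    {a b : V} (h : ∀ v ∈ A, D.IsShared v → v = a ∨ v = b) : D.DepthLE 2 A := by
  refine hA.depthLE_succ fun C hCA hCi hC _ => ?_
  suffices ∃ s ∈ C, D.IsSource s ∧ ∀ v ∈ C, D.IsShared v → ReflTransGen D.Adj s v by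
    obtain ⟨s, hsC, hs, hall⟩ := this
    exact ⟨s, hsC, hs, fun B hB hBi hBs => hD.depthLE_one hBi fun v hv hsh =>
      hBs v hv (hall v (hB hv) hsh)⟩
  have aux : ∀ a b : V, (∀ v ∈ C, D.IsShared v → v = a ∨ v = b) →
      ¬ (b ∈ C ∧ D.IsShared b) →
      ∃ s ∈ C, D.IsSource s ∧ ∀ v ∈ C, D.IsShared v → ReflTransGen D.Adj s v := by
    intro a b h hb
    by_cases ha : a ∈ C
    · obtain ⟨s, hs, hsa⟩ := hD.exists_source a
      refine ⟨s, hCi.mem_of_reaches hsa ha, hs, fun v hv hsh => ?_⟩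
      rcases h v hv hsh with rfl | rfl
      · exact hsa
      · exact absurd ⟨hv, hsh⟩ hb
    · obtain ⟨v, hv⟩ := hC.nonempty
      obtain ⟨s, hs, hsv⟩ := hD.exists_source v
      refine ⟨s, hCi.mem_of_reaches hsv hv, hs, fun v hv hsh => ?_⟩
      rcases h v hv hsh with rfl | rfl
      · exact absurd hv ha
      · exact absurd ⟨hv, hsh⟩ hb
  have hC' : ∀ v ∈ C, D.IsShared v → v = a ∨ v = b := fun v hv => h v (hCA hv)
  by_cases hb : b ∈ C ∧ D.IsShared b
  swap
  · exact aux a b hC' hb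
  by_cases ha : a ∈ C ∧ D.IsShared a
  swap
  · exact aux b a (fun v hv hsh => (hC' v hv hsh).symm) ha
  by_contra! hno
  have hno' : ∀ s, D.IsSource s → ReflTransGen D.Adj s a → ReflTransGen D.Adj s b → False := by
    intro s hs hsa hsb
    obtain ⟨v, hv, hsh, hn⟩ := hno s (hCi.mem_of_reaches hsa ha.1) hs
    rcases hC' v hv hsh with rfl | rfl
    · exact hn hsa
    · exact hn hsb
  -- The union of the reaches of all sources above `a` can only be left backwards at a shared
  -- vertex: at `a` the new source is again above `a`, and at `b` some source reaches both. So this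
  -- union contains `b`.
  have hsub : C ⊆ {v | ∃ s, D.IsSource s ∧ ReflTransGen D.Adj s a ∧ ReflTransGen D.Adj s v} := by
    obtain ⟨s, hs, hsa⟩ := hD.exists_source a
    refine subset_of_connected hC ha.1 ⟨s, hs, hsa, hsa⟩ ?_
    rintro u hu w hw ⟨s, hs, hsa, hsu⟩ (huw | hwu)
    · exact ⟨s, hs, hsa, hsu.tail huw⟩
    · obtain ⟨t, ht, htw⟩ := hD.exists_source w
      rcases eq_or_ne s t with rfl | hst
      · exact ⟨s, hs, hsa, htw⟩
      · rcases hC' u hu ⟨s, t, hst, hs, ht, hsu, htw.tail hwu⟩ with rfl | rfl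
        · exact ⟨t, ht, htw.tail hwu, htw⟩
        · exact (hno' s hs hsa hsu).elim
  obtain ⟨s, hs, hsa, hsb⟩ := hsub hb.1
  exact hno' s hs hsa hsb

/-- The component of `s` takes `s` as root. The other components are disjoint from the reach of `s`,
so they have at most two shared vertices from the start and any source will do. -/
theorem IsDAG.depthLE_three_of_source (hD : D.IsDAG) {s : V} (hs : D.IsSource s)
    (h : {v | D.IsShared v ∧ ¬ ReflTransGen D.Adj s v}.ncard ≤ 2) :
    D.DepthLE 3 Set.univ := by
  have hab : ∃ a b, ∀ v, D.IsShared v → ¬ ReflTransGen D.Adj s v → v = a ∨ v = b := by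
    have hcase : {v | D.IsShared v ∧ ¬ ReflTransGen D.Adj s v}.ncard = 0 ∨
        {v | D.IsShared v ∧ ¬ ReflTransGen D.Adj s v}.ncard = 1 ∨
        {v | D.IsShared v ∧ ¬ ReflTransGen D.Adj s v}.ncard = 2 := by lia
    rcases hcase with h | h | h
    · rw [Set.ncard_eq_zero (Set.toFinite _)] at h
      exact ⟨s, s, fun v h1 h2 => (Set.notMem_empty v (h ▸ ⟨h1, h2⟩)).elim⟩
    · obtain ⟨a, ha⟩ := Set.ncard_eq_one.1 h
      exact ⟨a, a, fun v h1 h2 => .inl (show v ∈ ({a} : Set V) from ha ▸ ⟨h1, h2⟩)⟩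
    · obtain ⟨a, b, _, ha⟩ := Set.ncard_eq_two.1 h
      exact ⟨a, b, fun v h1 h2 => (show v ∈ ({a, b} : Set V) from ha ▸ ⟨h1, h2⟩)⟩
  obtain ⟨a, b, hab⟩ := hab
  have huniv : D.InClosed Set.univ := fun _ _ _ _ => Set.mem_univ _
  refine huniv.depthLE_succ fun C _ hCi hC hcl => ?_
  by_cases hsC : s ∈ C
  · exact ⟨s, hsC, hs, fun B _ hBi hBs => hD.depthLE_two hBi fun v hv hsh =>
      hab v hsh (hBs v hv)⟩
  · have hdisj : ∀ v ∈ C, ¬ ReflTransGen D.Adj s v := fun v hv hsv =>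
      hsC (hCi.mem_of_reaches hsv hv)
    obtain ⟨v, hv⟩ := hC.nonempty
    obtain ⟨t, ht, htv⟩ := hD.exists_source v
    exact ⟨t, hCi.mem_of_reaches htv hv, ht, fun B hB hBi _ => hD.depthLE_two hBi
      fun v hv hsh => hab v hsh (hdisj v (hB hv))⟩

/-- Otherwise each of the `p` sources reaches at most `x - 3` of the `x` shared vertices, while each
shared vertex is reached at least twice: `2x ≤ p(x - 3)`. Sources are not shared, so `p + x ≤ 9`. -/
theorem exists_source_ncard_le_two (hV : Nat.card V ≤ 9)
    (hsrc : 3 < {s | D.IsSource s}.ncard) :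
    ∃ s, D.IsSource s ∧ {v | D.IsShared v ∧ ¬ ReflTransGen D.Adj s v}.ncard ≤ 2 := by
  classical
  have := Fintype.ofFinite V
  by_contra! hno
  set P : Finset V := {s | D.IsSource s} with hP
  set X : Finset V := {v | D.IsShared v} with hX
  have hPc : {s | D.IsSource s}.ncard = P.card := by
    rw [← Set.ncard_coe_finset]; simp [hP]
  have hdisj : Disjoint P X := by
    rw [Finset.disjoint_left]
    simp only [hP, hX, Finset.mem_filter_univ]
    exact fun s hs => hs.not_isShared
  have hsum : P.card + X.card ≤ 9 := by
    rw [← Finset.card_union_of_disjoint hdisj]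
    exact (Finset.card_le_univ _).trans (by rwa [← Nat.card_eq_fintype_card])
  have hdc := Finset.sum_card_bipartiteAbove_eq_sum_card_bipartiteBelow
    (s := P) (t := X) (fun s v => ReflTransGen D.Adj s v)
  have hlow : ∀ v ∈ X, 2 ≤ (P.bipartiteBelow (fun s v => ReflTransGen D.Adj s v) v).card := by
    intro v hv
    obtain ⟨s, t, hne, hs, ht, hsv, htv⟩ : D.IsShared v := by simpa [hX] using hv
    refine Finset.one_lt_card.2 ⟨s, ?_, t, ?_, hne⟩ <;>
      simp [Finset.bipartiteBelow, *]
  have hup : ∀ s ∈ P, (X.bipartiteAbove (fun s v => ReflTransGen D.Adj s v) s).card + 3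
      ≤ X.card := by
    intro s hs
    have h := hno s (by simpa [hP] using hs)
    have hc : {v | D.IsShared v ∧ ¬ ReflTransGen D.Adj s v}.ncard =
        (X.filter fun v => ¬ ReflTransGen D.Adj s v).card := by
      rw [← Set.ncard_coe_finset]; congr 1; ext; simp [hX]
    have := Finset.card_filter_add_card_filter_not (s := X)
      (fun v => ReflTransGen D.Adj s v)
    rw [hc] at h
    simp only [Finset.bipartiteAbove]
    lia
  have h1 : X.card * 2 ≤ ∑ v ∈ X,
      (P.bipartiteBelow (fun s v => ReflTransGen D.Adj s v) v).card := by
    rw [← smul_eq_mul]; exact Finset.card_nsmul_le_sum _ _ _ hlow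
  have h2 : ∑ s ∈ P, (X.bipartiteAbove (fun s v => ReflTransGen D.Adj s v) s).card
      ≤ P.card * (X.card - 3) := by
    rw [← smul_eq_mul]
    exact Finset.sum_le_card_nsmul _ _ _ fun s hs => Nat.le_sub_of_add_le (hup s hs)
  have h3 : 3 ≤ X.card := by
    obtain ⟨s, hs⟩ : P.Nonempty := Finset.card_pos.1 (by lia)
    have := hup s hs
    lia
  have h4 : X.card ≤ 5 := by lia
  have h5 : X.card * 2 ≤ P.card * (X.card - 3) := h1.trans (hdc ▸ h2)
  -- For `x = 3, 4, 5` the right side is at most `0, 5, 8`, and the left side is `6, 8, 10`.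
  interval_cases X.card <;> lia

theorem IsDAG.dagTreedepth_le_three (hD : D.IsDAG) (hV : Nat.card V ≤ 9) :
    D.dagTreedepth ≤ 3 := by
  have : D.DepthLE 3 Set.univ := by
    by_cases hsrc : 3 < {s | D.IsSource s}.ncard
    · obtain ⟨s, hs, h⟩ := exists_source_ncard_le_two hV hsrc
      exact hD.depthLE_three_of_source hs h
    · refine hD.depthLE_of_ncard_sources 3 (fun _ _ _ _ => Set.mem_univ _) ?_
      simpa using not_lt.1 hsrc
  obtain ⟨F, hF⟩ := this.exists_elimForest
  exact (iInf_le _ F).trans hF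

end Digraph

/-! ### Counting expressions, their size and their cost. -/

namespace RAM

/-- The binary arithmetic operations of the machine. -/
inductive BinOp
  | add
  | sub
  | mul
  | div

/-- The value of a binary operation. -/
def BinOp.eval : BinOp → ℕ → ℕ → ℕ
  | .add, a, b => a + b
  | .sub, a, b => a - b
  | .mul, a, b => a * b
  | .div, a, b => a / b

/-- The machine operation that computes a binary operation. -/
def BinOp.toOp {ρ : Type} : BinOp → ρ → ρ → Op ρ
  | .add => .add
  | .sub => .sub
  | .mul => .mul
  | .div => .div

theorem BinOp.eval_le (o : BinOp) (a b : ℕ) : o.eval a b ≤ (a + 1) * (b + 1) := by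
  cases o
  · simp only [eval]; nlinarith [Nat.zero_le (a * b)]
  · simp only [eval]; nlinarith [Nat.sub_le a b, Nat.zero_le (a * b)]
  · simp only [eval]; nlinarith
  · simp only [eval]; nlinarith [Nat.div_le_self a b, Nat.zero_le (a * b)]

/-- Counting expressions with variables from `V`, which range over vertex numbers. The expression
`bind x y i e` is the value of `e` with `x` replaced by entry `i` of the out-neighbour list of `y`,
and `sum x e` is the sum of the values of `e` over all vertices `x`. -/
inductive Expr (V : Type)
  | lit (a : ℕ)
  | var (x : V)
  | deg (x : V)
  | bin (o : BinOp) (e f : Expr V)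
  | bind (x y : V) (i : ℕ) (e : Expr V)
  | sum (x : V) (e : Expr V)

namespace Expr

variable {V : Type} {n d : ℕ} {G : SimpleGraph (Fin n)}

/-- The value of an expression on an input, for given values of the variables. -/
def eval [DecidableEq V] (I : HostInput G d) : Expr V → (V → ℕ) → ℕ
  | lit a, _ => a
  | var x, σ => σ x
  | deg x, σ => I.outdegree (σ x)
  | bin o e f, σ => o.eval (e.eval I σ) (f.eval I σ)
  | bind x y i e, σ => e.eval I (Function.update σ x (I.outNeighbour (σ y) i))
  | sum x e, σ => ∑ v ∈ Finset.range n, e.eval I (Function.update σ x v)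

/-- The nesting depth of the sums over all vertices. -/
def depth : Expr V → ℕ
  | lit _ => 0
  | var _ => 0
  | deg _ => 0
  | bin _ e f => max e.depth f.depth
  | bind _ _ _ e => e.depth
  | sum _ e => e.depth + 1

/-- Renaming of variables. -/
def map {V' : Type} (g : V → V') : Expr V → Expr V'
  | lit a => lit a
  | var x => var (g x)
  | deg x => deg (g x)
  | bin o e f => bin o (e.map g) (f.map g)
  | bind x y i e => bind (g x) (g y) i (e.map g)
  | sum x e => sum (g x) (e.map g)

theorem depth_map {V' : Type} (g : V → V') (e : Expr V) : (e.map g).depth = e.depth := by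
  induction e <;> simp_all [map, depth]

theorem eval_map [DecidableEq V] {V' : Type} [DecidableEq V'] {g : V → V'}
    (hg : Function.Injective g) (I : HostInput G d) (e : Expr V) (σ : V' → ℕ) :
    (e.map g).eval I σ = e.eval I (σ ∘ g) := by
  induction e generalizing σ with
  | lit a => rfl
  | var x => rfl
  | deg x => rfl
  | bin o e f ihe ihf => simp only [map, eval, ihe, ihf]
  | bind x y i e ih =>
    simp only [map, eval, ih, Function.update_comp_eq_of_injective _ hg, Function.comp_apply]
  | sum x e ih =>
    simp only [map, eval, ih, Function.update_comp_eq_of_injective _ hg]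

/-- All variables are registers below `r`. -/
def VarsLT (r : ℕ) : Expr ℕ → Prop
  | lit _ => True
  | var x => x < r
  | deg x => x < r
  | bin _ e f => e.VarsLT r ∧ f.VarsLT r
  | bind x y _ e => x < r ∧ y < r ∧ e.VarsLT r
  | sum x e => x < r ∧ e.VarsLT r

theorem VarsLT.mono {e : Expr ℕ} {r s : ℕ} (h : e.VarsLT r) (hrs : r ≤ s) : e.VarsLT s := by
  induction e with
  | lit a => trivial
  | var x => exact lt_of_lt_of_le h hrs
  | deg x => exact lt_of_lt_of_le h hrs
  | bin o e f ihe ihf => exact ⟨ihe h.1, ihf h.2⟩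
  | bind x y i e ih => exact ⟨h.1.trans_le hrs, h.2.1.trans_le hrs, ih h.2.2⟩
  | sum x e ih => exact ⟨h.1.trans_le hrs, ih h.2⟩

theorem exists_varsLT (e : Expr ℕ) : ∃ r, e.VarsLT r := by
  induction e with
  | lit a => exact ⟨0, trivial⟩
  | var x => exact ⟨x + 1, Nat.lt_succ_self x⟩
  | deg x => exact ⟨x + 1, Nat.lt_succ_self x⟩
  | bin o e f ihe ihf =>
    obtain ⟨r, hr⟩ := ihe
    obtain ⟨s, hs⟩ := ihf
    exact ⟨max r s, hr.mono (le_max_left _ _), hs.mono (le_max_right _ _)⟩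
  | bind x y i e ih =>
    obtain ⟨r, hr⟩ := ih
    exact ⟨r + x + y + 1, by lia, by lia, hr.mono (by lia)⟩
  | sum x e ih =>
    obtain ⟨r, hr⟩ := ih
    exact ⟨r + x + 1, by lia, hr.mono (by lia)⟩

/-- The values of an expression do not depend on registers that are not variables of it. -/
theorem VarsLT.eval_congr {e : Expr ℕ} {r : ℕ} (h : e.VarsLT r) (I : HostInput G d)
    {σ τ : ℕ → ℕ} (hστ : ∀ i < r, σ i = τ i) : e.eval I σ = e.eval I τ := by
  have upd : ∀ {σ τ : ℕ → ℕ} (x v : ℕ), (∀ i < r, σ i = τ i) →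
      ∀ i < r, Function.update σ x v i = Function.update τ x v i := by
    intro σ τ x v h i hi
    simp only [Function.update_apply, h i hi]
  induction e generalizing σ τ with
  | lit a => rfl
  | var x => exact hστ x h
  | deg x => simp only [eval, hστ x h]
  | bin o e f ihe ihf => simp only [eval, ihe h.1 hστ, ihf h.2 hστ]
  | bind x y i e ih =>
    simp only [eval, hστ y h.2.1]
    exact ih h.2.2 (upd _ _ hστ)
  | sum x e ih => exact Finset.sum_congr rfl fun v _ => ih h.2 (upd _ _ hστ)

/-- A bound on the values that arise when an expression is evaluated. -/
def bound (d n : ℕ) : Expr V → ℕ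
  | lit a => a
  | var _ => n
  | deg _ => d
  | bin _ e f => (e.bound d n + 1) * (f.bound d n + 1)
  -- The saved variable, the index `i` and the neighbour are also written to registers.
  | bind _ _ i e => n + i + e.bound d n
  | sum _ e => (n + 1) * (e.bound d n + 1)

/-- A bound on the time in which an expression can be evaluated. -/
def time (n : ℕ) : Expr V → ℕ
  | lit _ => 1
  | var _ => 1
  | deg _ => 1
  | bin _ e f => e.time n + f.time n + 1
  | bind _ _ _ e => e.time n + 5
  -- Per round: one test and four assignments besides the body. Outside: three initialisations, the
  -- final test and the restoration of the variable.
  | sum _ e => n * (e.time n + 5) + 5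

theorem exists_bound_le (d : ℕ) (e : Expr V) : ∃ C w, ∀ n, e.bound d n ≤ C * (n + 1) ^ w := by
  have key : ∀ {f g : ℕ → ℕ}, (∃ C w, ∀ n, f n ≤ C * (n + 1) ^ w) →
      (∃ C w, ∀ n, g n ≤ C * (n + 1) ^ w) →
      ∃ C w, ∀ n, (f n + 1) * (g n + 1) ≤ C * (n + 1) ^ w := by
    rintro f g ⟨C, w, h⟩ ⟨C', w', h'⟩
    refine ⟨(C + 1) * (C' + 1), w + w', fun n => ?_⟩
    have h1 : 1 ≤ (n + 1) ^ w := Nat.one_le_pow _ _ (Nat.succ_pos n)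
    have h2 : 1 ≤ (n + 1) ^ w' := Nat.one_le_pow _ _ (Nat.succ_pos n)
    calc (f n + 1) * (g n + 1) ≤ (C * (n + 1) ^ w + (n + 1) ^ w) *
          (C' * (n + 1) ^ w' + (n + 1) ^ w') :=
          Nat.mul_le_mul (Nat.add_le_add (h n) h1) (Nat.add_le_add (h' n) h2)
      _ = (C + 1) * (C' + 1) * (n + 1) ^ (w + w') := by ring
  have lin : ∀ i, ∃ C w, ∀ n : ℕ, n + i ≤ C * (n + 1) ^ w := fun i =>
    ⟨i + 1, 1, fun n => by nlinarith [Nat.zero_le (i * n)]⟩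
  induction e with
  | lit a => exact ⟨a, 0, fun n => by simp [bound]⟩
  | var x => exact lin 0
  | deg x => exact ⟨d, 0, fun n => by simp [bound]⟩
  | bin o e f ihe ihf => exact key ihe ihf
  | bind x y i e ih =>
    obtain ⟨C, w, h⟩ := key (lin i) ih
    exact ⟨C, w, fun n => le_trans (by simp only [bound]; nlinarith) (h n)⟩
  | sum x e ih => exact key (lin 0) ih

theorem exists_time_le (e : Expr V) : ∃ C, ∀ n, e.time n ≤ C * (n + 1) ^ e.depth := by
  induction e with
  | lit a => exact ⟨1, fun n => by simp [time, depth]⟩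
  | var a => exact ⟨1, fun n => by simp [time, depth]⟩
  | deg a => exact ⟨1, fun n => by simp [time, depth]⟩
  | bin o e f ihe ihf =>
    obtain ⟨C, h⟩ := ihe
    obtain ⟨C', h'⟩ := ihf
    refine ⟨C + C' + 1, fun n => ?_⟩
    have h1 : (n + 1) ^ e.depth ≤ (n + 1) ^ max e.depth f.depth :=
      Nat.pow_le_pow_right (Nat.succ_pos n) (le_max_left _ _)
    have h2 : (n + 1) ^ f.depth ≤ (n + 1) ^ max e.depth f.depth :=
      Nat.pow_le_pow_right (Nat.succ_pos n) (le_max_right _ _)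
    have h3 : 1 ≤ (n + 1) ^ max e.depth f.depth := Nat.one_le_pow _ _ (Nat.succ_pos n)
    simp only [time, depth]
    have h4 := (h n).trans (Nat.mul_le_mul_left C h1)
    have h5 := (h' n).trans (Nat.mul_le_mul_left C' h2)
    linarith
  | bind x y i e ih =>
    obtain ⟨C, h⟩ := ih
    refine ⟨C + 5, fun n => ?_⟩
    have h3 : 1 ≤ (n + 1) ^ e.depth := Nat.one_le_pow _ _ (Nat.succ_pos n)
    simp only [time, depth]
    linarith [h n]
  | sum x e ih =>
    obtain ⟨C, h⟩ := ih
    refine ⟨C + 5, fun n => ?_⟩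
    have h3 : 1 ≤ (n + 1) ^ e.depth := Nat.one_le_pow _ _ (Nat.succ_pos n)
    simp only [time, depth, pow_succ]
    have := Nat.mul_le_mul_left n (h n)
    nlinarith

end Expr

end RAM

namespace HostInput

variable {n d : ℕ} {G : SimpleGraph (Fin n)}

theorem outdegree_le (I : HostInput G d) (v : ℕ) : I.outdegree v ≤ d := by
  unfold outdegree
  split
  · exact I.length_le _
  · exact Nat.zero_le _

theorem outNeighbour_le (I : HostInput G d) (v i : ℕ) : I.outNeighbour v i ≤ n := by
  unfold outNeighbour
  split
  · rename_i h
    cases (I.out ⟨v, h⟩)[i]? with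
    | none => exact Nat.zero_le _
    | some w => exact w.2.le
  · exact Nat.zero_le _

end HostInput

/-! ### Compilation of expressions into RAM programs. -/

namespace RAM

variable {n d : ℕ} {G : SimpleGraph (Fin n)}

theorem Expr.eval_le {V : Type} [DecidableEq V] (I : HostInput G d) (e : Expr V) {σ : V → ℕ}
    (hσ : ∀ v, σ v ≤ n) : e.eval I σ ≤ e.bound d n := by
  have upd : ∀ {σ : V → ℕ} (x : V) {v : ℕ}, (∀ v, σ v ≤ n) → v ≤ n →
      ∀ i, Function.update σ x v i ≤ n := by
    intro σ x v h hv i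
    rw [Function.update_apply]
    split
    · exact hv
    · exact h i
  induction e generalizing σ with
  | lit a => exact le_rfl
  | var x => exact hσ x
  | deg x => exact I.outdegree_le _
  | bin o e f ihe ihf =>
    exact (o.eval_le _ _).trans (Nat.mul_le_mul (Nat.succ_le_succ (ihe hσ))
      (Nat.succ_le_succ (ihf hσ)))
  | bind x y i e ih =>
    exact (ih (upd x hσ (I.outNeighbour_le _ _))).trans (Nat.le_add_left _ _)
  | sum x e ih =>
    have := Finset.sum_le_card_nsmul (Finset.range n)
      (fun v => e.eval I (Function.update σ x v)) (e.bound d n)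
      fun v hv => ih (upd x hσ (Finset.mem_range.1 hv).le)
    simp only [Finset.card_range, smul_eq_mul] at this
    simp only [eval, bound]
    nlinarith

/-- The program `p`, started with register contents `σ`, halts after at most `T` steps with
register contents that satisfy `Q`. -/
def Runs {ρ : Type} [DecidableEq ρ] (I : HostInput G d) (B : ℕ) (p : Prog ρ) (σ : ρ → ℕ) (T : ℕ)
    (Q : (ρ → ℕ) → Prop) : Prop :=
  ∃ t τ, Exec I B p σ t τ ∧ t ≤ T ∧ Q τ

section Runs

variable {ρ : Type} [DecidableEq ρ] {I : HostInput G d} {B : ℕ}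

theorem Runs.mono {p : Prog ρ} {σ : ρ → ℕ} {T T' : ℕ} {Q Q' : (ρ → ℕ) → Prop}
    (h : Runs I B p σ T Q) (hT : T ≤ T') (hQ : ∀ τ, Q τ → Q' τ) : Runs I B p σ T' Q' := by
  obtain ⟨t, τ, hE, ht, hτ⟩ := h
  exact ⟨t, τ, hE, ht.trans hT, hQ τ hτ⟩

theorem Runs.assign {x : ρ} {o : Op ρ} {σ : ρ → ℕ} {Q : (ρ → ℕ) → Prop} (h : o.eval I σ ≤ B)
    (hQ : Q (Function.update σ x (o.eval I σ))) : Runs I B (.assign x o) σ 1 Q :=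
  ⟨1, _, .assign x o σ h, le_rfl, hQ⟩

theorem Runs.seq {p q : Prog ρ} {σ : ρ → ℕ} {S T : ℕ} {Q : (ρ → ℕ) → Prop}
    (h : Runs I B p σ S fun τ => Runs I B q τ T Q) : Runs I B (.seq p q) σ (S + T) Q := by
  obtain ⟨s, τ, hp, hs, t, υ, hq, ht, hυ⟩ := h
  exact ⟨s + t, υ, .seq hp hq, Nat.add_le_add hs ht, hυ⟩

theorem Runs.assign_seq {x : ρ} {o : Op ρ} {q : Prog ρ} {σ : ρ → ℕ} {T : ℕ}
    {Q : (ρ → ℕ) → Prop} (h : o.eval I σ ≤ B)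
    (hQ : Runs I B q (Function.update σ x (o.eval I σ)) T Q) :
    Runs I B (.seq (.assign x o) q) σ (1 + T) Q :=
  .seq (.assign h hQ)

end Runs

/-- A program that evaluates an expression whose variables are registers below `r`. The result is
in register `r`, and the registers below `r` are preserved. -/
def Expr.compile : Expr ℕ → ℕ → Prog ℕ
  | lit a, r => .assign r (.const a)
  | var x, r => .assign r (.copy x)
  | deg x, r => .assign r (.outdegree x)
  | bin o e f, r => .seq (e.compile r) (.seq (f.compile (r + 1)) (.assign r (o.toOp r (r + 1))))
  | bind x y i e, r =>
    .seq (.assign (r + 1) (.copy x)) <|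
    .seq (.assign (r + 2) (.const i)) <|
    .seq (.assign x (.outNeighbour y (r + 2))) <|
    .seq (e.compile (r + 2)) <|
    .seq (.assign r (.copy (r + 2))) <|
    .assign x (.copy (r + 1))
  | sum x e, r =>
    -- Register `r` accumulates, `r + 1` saves `x`, `r + 2` counts down, and `r + 3` holds first the
    -- constant one and then the value of the body.
    .seq (.assign r (.const 0)) <|
    .seq (.assign (r + 1) (.copy x)) <|
    .seq (.assign (r + 2) .size) <|
    .seq (.whileNZ (r + 2) <|
      .seq (.assign (r + 3) (.const 1)) <|
      .seq (.assign (r + 2) (.sub (r + 2) (r + 3))) <|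
      .seq (.assign x (.copy (r + 2))) <|
      .seq (e.compile (r + 3)) <|
      .assign r (.add r (r + 3))) <|
    .assign x (.copy (r + 1))

theorem BinOp.eval_toOp {ρ : Type} (I : HostInput G d) (o : BinOp) (σ : ρ → ℕ) (x y : ρ) :
    (o.toOp x y).eval I σ = o.eval (σ x) (σ y) := by
  cases o <;> rfl

end RAM

namespace RAM

variable {n d : ℕ} {G : SimpleGraph (Fin n)}

theorem Expr.VarsLT.eval_le {e : Expr ℕ} {s : ℕ} (he : e.VarsLT s) (I : HostInput G d)
    {σ : ℕ → ℕ} (hσ : ∀ i < s, σ i ≤ n) : e.eval I σ ≤ e.bound d n := by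
  rw [he.eval_congr I (τ := fun i => if i < s then σ i else 0)
    fun i hi => by simp only [hi, if_true]]
  refine e.eval_le I fun i => ?_
  split
  · exact hσ i ‹_›
  · exact Nat.zero_le _

/-- A loop that runs through the values `j - 1, …, 0` of register `x` and adds up the results of
its body in register `r`. -/
theorem Runs.countdown {I : HostInput G d} {B r x s : ℕ} {p : Prog ℕ} {T K : ℕ} {f : ℕ → ℕ}
    {σ₀ : ℕ → ℕ} (hx : x < s) (hs : s ≤ r) (hB : n + 1 ≤ B)
    (hK : K ≤ B)
    (hp : ∀ v < n, ∀ σ : ℕ → ℕ, (∀ i < r, i ≠ x → σ i = σ₀ i) → σ x = v →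
      Runs I B p σ T fun τ => τ (r + 3) = f v ∧ ∀ i < r + 3, τ i = σ i)
    (hsum : ∑ v ∈ Finset.range n, f v ≤ K) (j : ℕ) (hj : j ≤ n) (σ : ℕ → ℕ)
    (hσ : ∀ i < r, i ≠ x → σ i = σ₀ i) (hσj : σ (r + 2) = j)
    -- Loop invariant: the accumulator already contains the terms with `v ≥ j`.
    (hσr : σ r + ∑ v ∈ Finset.range j, f v = ∑ v ∈ Finset.range n, f v) :
    Runs I B (.whileNZ (r + 2) <|
      .seq (.assign (r + 3) (.const 1)) <|
      .seq (.assign (r + 2) (.sub (r + 2) (r + 3))) <|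
      .seq (.assign x (.copy (r + 2))) <|
      .seq p <|
      .assign r (.add r (r + 3))) σ (j * (T + 5) + 1)
      fun τ => τ r = ∑ v ∈ Finset.range n, f v ∧ τ (r + 1) = σ (r + 1) ∧
        ∀ i < r, i ≠ x → τ i = σ₀ i := by
  induction j generalizing σ with
  | zero =>
    exact ⟨1, σ, .while_false hσj, by simp, by simpa using hσr, rfl, hσ⟩
  | succ j ih =>
    have body : Runs I B
        (.seq (.assign (r + 3) (.const 1)) <|
        .seq (.assign (r + 2) (.sub (r + 2) (r + 3))) <|
        .seq (.assign x (.copy (r + 2))) <|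
        .seq p <|
        .assign r (.add r (r + 3))) σ (1 + (1 + (1 + (T + 1)))) fun τ =>
          (∀ i < r, i ≠ x → τ i = σ₀ i) ∧ τ (r + 1) = σ (r + 1) ∧ τ (r + 2) = j ∧
          τ r = σ r + f j := by
      refine .assign_seq (by simp only [Op.eval]; lia) ?_
      refine .assign_seq ?_ ?_
      · simp only [Op.eval, Function.update_apply]
        simp
        lia
      refine .assign_seq ?_ ?_
      · simp only [Op.eval, Function.update_apply]
        simp
        lia
      refine .seq ((hp j (by lia) _ ?_ ?_).mono le_rfl ?_)
      · intro i hi hix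
        simp only [Function.update_apply]
        rw [if_neg hix, if_neg (by lia), if_neg (by lia), hσ i hi hix]
      · simp [Op.eval, hσj]
      · rintro τ ⟨hτ, hτ'⟩
        have e1 : τ r = σ r := by
          rw [hτ' r (by lia)]
          simp only [Function.update_apply]
          rw [if_neg (by lia), if_neg (by lia), if_neg (by lia)]
        have e2 : τ (r + 1) = σ (r + 1) := by
          rw [hτ' _ (by lia)]
          simp only [Function.update_apply]
          rw [if_neg (by lia), if_neg (by lia), if_neg (by lia)]
        have e3 : τ (r + 2) = j := by
          rw [hτ' _ (by lia)]
          simp only [Function.update_apply, Op.eval]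
          rw [if_neg (by lia)]
          simp [hσj]
        refine .assign ?_ ⟨fun i hi hix => ?_, ?_, ?_, ?_⟩
        · simp only [Op.eval, hτ, e1]
          rw [Finset.sum_range_succ] at hσr
          lia
        · rw [Function.update_apply, if_neg (by lia), hτ' i (by lia)]
          simp only [Function.update_apply]
          rw [if_neg hix, if_neg (by lia), if_neg (by lia), hσ i hi hix]
        · rw [Function.update_apply, if_neg (by lia), e2]
        · rw [Function.update_apply, if_neg (by lia), e3]
        · simp [Op.eval, hτ, e1]
    obtain ⟨t, τ, hE, ht, h1, h2, h3, h4⟩ := body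
    obtain ⟨t', υ, hE', ht', g1, g2, g3⟩ := ih (by lia) τ h1 h3 (by
      rw [Finset.sum_range_succ] at hσr; lia)
    refine ⟨t + t' + 1, υ, .while_true (by lia) hE hE', ?_, g1, g2.trans h2, g3⟩
    have : (j + 1) * (T + 5) = j * (T + 5) + (T + 5) := by ring
    lia

/-- Two thresholds are needed: the variables stay below the fixed `s`, while subexpressions are
compiled with ever larger output registers `r`, so their work overwrites neither the variables nor
pending results. -/
theorem Expr.runs_compile (I : HostInput G d) (e : Expr ℕ) {B s r : ℕ} (he : e.VarsLT s)
    (hs : s ≤ r) {σ : ℕ → ℕ} (hσ : ∀ i < s, σ i ≤ n) (hB : e.bound d n ≤ B) :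
    Runs I B (e.compile r) σ (e.time n)
      fun τ => τ r = e.eval I σ ∧ ∀ i < r, τ i = σ i := by
  have upd : ∀ {σ : ℕ → ℕ} (x : ℕ) {v : ℕ}, (∀ i < s, σ i ≤ n) → v ≤ n →
      ∀ i < s, Function.update σ x v i ≤ n := by
    intro σ x v h hv i hi
    rw [Function.update_apply]
    split
    · exact hv
    · exact h i hi
  induction e generalizing σ r with
  | lit a =>
    refine .assign hB ⟨by simp [Op.eval, eval], fun i hi => ?_⟩
    rw [Function.update_apply, if_neg (by lia)]
  | var x =>
    refine .assign ((hσ x he).trans hB) ⟨by simp [Op.eval, eval], fun i hi => ?_⟩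
    rw [Function.update_apply, if_neg (by lia)]
  | deg x =>
    refine .assign ((I.outdegree_le _).trans hB) ⟨by simp [Op.eval, eval], fun i hi => ?_⟩
    rw [Function.update_apply, if_neg (by lia)]
  | bin o e f ihe ihf =>
    have hB' : (e.bound d n + 1) * (f.bound d n + 1) ≤ B := hB
    have hev := (VarsLT.eval_le he I hσ).trans hB
    simp only [compile, time]
    rw [add_assoc]
    refine .seq ((ihe he.1 hs hσ (by nlinarith)).mono le_rfl ?_)
    rintro τ ⟨h1, h2⟩
    have hτ : ∀ i < s, τ i = σ i := fun i hi => h2 i (by lia)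
    refine .seq ((ihf he.2 (by lia) (fun i hi => by rw [hτ i hi]; exact hσ i hi)
      (by nlinarith)).mono le_rfl ?_)
    rintro υ ⟨g1, g2⟩
    have hval : (o.toOp r (r + 1)).eval I υ = (bin o e f).eval I σ := by
      rw [BinOp.eval_toOp, g1, g2 r (by lia), h1, he.2.eval_congr I hτ]
      rfl
    refine .assign (hval ▸ hev) ⟨by rw [Function.update_self, hval], fun i hi => ?_⟩
    rw [Function.update_apply, if_neg (by lia), g2 i (by lia), h2 i hi]
  | bind x y i e ih =>
    obtain ⟨hx, hy, he⟩ := he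
    have hB' : n + i + e.bound d n ≤ B := hB
    have hxn := hσ x hx
    simp only [compile, time]
    rw [show e.time n + 5 = 1 + (1 + (1 + (e.time n + (1 + 1)))) by ring]
    refine .assign_seq (by simp only [Op.eval]; lia) ?_
    refine .assign_seq (by simp only [Op.eval]; lia) ?_
    refine .assign_seq ((I.outNeighbour_le _ _).trans (by lia)) ?_
    have hnb : (Op.outNeighbour y (r + 2)).eval I (Function.update
        (Function.update σ (r + 1) ((Op.copy x).eval I σ)) (r + 2)
        ((Op.const i).eval I (Function.update σ (r + 1) ((Op.copy x).eval I σ)))) =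
        I.outNeighbour (σ y) i := by
      simp only [Op.eval, Function.update_apply]
      rw [if_neg (by lia), if_neg (by lia), if_pos trivial]
    rw [hnb]
    have hag : ∀ k < r, Function.update (Function.update
        (Function.update σ (r + 1) ((Op.copy x).eval I σ)) (r + 2)
        ((Op.const i).eval I (Function.update σ (r + 1) ((Op.copy x).eval I σ)))) x
          (I.outNeighbour (σ y) i) k =
        Function.update σ x (I.outNeighbour (σ y) i) k := by
      intro k hk
      simp only [Function.update_apply]
      rw [if_neg (show k ≠ r + 2 by lia), if_neg (show k ≠ r + 1 by lia)]
    refine .seq ((ih (r := r + 2) he (by lia) ?_ (by lia)).mono le_rfl ?_)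
    · intro k hk
      rw [hag k (by lia)]
      exact upd x hσ (I.outNeighbour_le _ _) k hk
    rintro τ ⟨h1, h2⟩
    rw [he.eval_congr I fun k hk => hag k (by lia)] at h1
    have hev := (he.eval_le I (upd x hσ (I.outNeighbour_le (σ y) i)))
    have hsave : τ (r + 1) = σ x := by
      rw [h2 _ (by lia)]
      simp only [Function.update_apply, Op.eval]
      rw [if_neg (by lia), if_neg (by lia), if_pos trivial]
    refine .assign_seq (by simp only [Op.eval]; lia) ?_
    refine .assign ?_ ⟨?_, fun k hk => ?_⟩
    · simp only [Op.eval]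
      rw [Function.update_apply, if_neg (by lia)]
      lia
    · simp only [Op.eval]
      rw [Function.update_apply, if_neg (by lia), Function.update_self, h1]
      rfl
    · simp only [Op.eval]
      rw [Function.update_apply]
      split
      · subst k
        rw [Function.update_apply, if_neg (by lia), hsave]
      · rw [Function.update_apply, if_neg (by lia), h2 k (by lia), hag k hk,
          Function.update_apply, if_neg ‹_›]
  | sum x e ih =>
    obtain ⟨hx, he⟩ := he
    have hB' : (n + 1) * (e.bound d n + 1) ≤ B := hB
    have hxn := hσ x hx
    have hn1 : n + 1 ≤ B := by nlinarith
    have hsumle : ∑ v ∈ Finset.range n, e.eval I (Function.update σ x v) ≤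
        (n + 1) * (e.bound d n + 1) := by
      have := Finset.sum_le_card_nsmul (Finset.range n)
        (fun v => e.eval I (Function.update σ x v)) (e.bound d n)
        fun v hv => he.eval_le I (upd x hσ (Finset.mem_range.1 hv).le)
      simp only [Finset.card_range, smul_eq_mul] at this
      nlinarith
    simp only [compile, time]
    rw [show n * (e.time n + 5) + 5 = 1 + (1 + (1 + (n * (e.time n + 5) + 1 + 1))) by ring]
    refine .assign_seq (Nat.zero_le _) ?_
    refine .assign_seq ?_ ?_
    · simp only [Op.eval]
      rw [Function.update_apply, if_neg (by lia)]
      lia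
    refine .assign_seq (by simp only [Op.eval]; lia) ?_
    refine .seq ((Runs.countdown (σ₀ := σ) hx hs hn1 hB' ?_
      hsumle n le_rfl _ ?_ ?_ ?_).mono le_rfl ?_)
    · intro v hv τ hτ hτx
      have hag : ∀ k < s, τ k = Function.update σ x v k := by
        intro k hk
        rw [Function.update_apply]
        split
        · subst k; exact hτx
        · exact hτ k (by lia) ‹_›
      refine (ih (r := r + 3) he (by lia) (fun k hk => ?_) (by nlinarith)).mono le_rfl ?_
      · rw [hag k hk]
        exact upd x hσ hv.le k hk
      · rintro υ ⟨h1, h2⟩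
        exact ⟨by rw [h1, he.eval_congr I hag], h2⟩
    · intro k hk _
      simp only [Function.update_apply]
      rw [if_neg (by lia), if_neg (by lia), if_neg (by lia)]
    · simp [Op.eval]
    · simp only [Function.update_apply, Op.eval]
      rw [if_neg (by lia), if_neg (by lia), if_pos trivial, zero_add]
    · rintro τ ⟨h1, h2, h3⟩
      have hsave : τ (r + 1) = σ x := by
        rw [h2]
        simp only [Function.update_apply, Op.eval]
        rw [if_neg (by lia), if_pos trivial, if_neg (by lia)]
      refine .assign ?_ ⟨?_, fun k hk => ?_⟩
      · simp only [Op.eval]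
        lia
      · rw [Function.update_apply, if_neg (by lia), h1]
        rfl
      · simp only [Op.eval]
        rw [Function.update_apply]
        split
        · subst k; exact hsave
        · exact h3 k hk ‹_›

/-- All registers of the operation satisfy `S`. -/
def Op.Uses {ρ : Type} (S : ρ → Prop) : Op ρ → Prop
  | .const _ => True
  | .copy x => S x
  | .add x y => S x ∧ S y
  | .sub x y => S x ∧ S y
  | .mul x y => S x ∧ S y
  | .div x y => S x ∧ S y
  | .size => True
  | .outdegree x => S x
  | .outNeighbour x y => S x ∧ S y

/-- All registers of the program satisfy `S`. -/
def Prog.Uses {ρ : Type} (S : ρ → Prop) : Prog ρ → Prop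
  | .skip => True
  | .assign x o => S x ∧ o.Uses S
  | .seq p q => p.Uses S ∧ q.Uses S
  | .ifNZ x p q => S x ∧ p.Uses S ∧ q.Uses S
  | .whileNZ x p => S x ∧ p.Uses S

/-- Renaming of the registers of an operation. -/
def Op.map {ρ ρ' : Type} (g : ρ → ρ') : Op ρ → Op ρ'
  | .const a => .const a
  | .copy x => .copy (g x)
  | .add x y => .add (g x) (g y)
  | .sub x y => .sub (g x) (g y)
  | .mul x y => .mul (g x) (g y)
  | .div x y => .div (g x) (g y)
  | .size => .size
  | .outdegree x => .outdegree (g x)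
  | .outNeighbour x y => .outNeighbour (g x) (g y)

/-- Renaming of the registers of a program. -/
def Prog.map {ρ ρ' : Type} (g : ρ → ρ') : Prog ρ → Prog ρ'
  | .skip => .skip
  | .assign x o => .assign (g x) (o.map g)
  | .seq p q => .seq (p.map g) (q.map g)
  | .ifNZ x p q => .ifNZ (g x) (p.map g) (q.map g)
  | .whileNZ x p => .whileNZ (g x) (p.map g)

theorem Op.eval_map {ρ ρ' : Type} (I : HostInput G d) {S : ρ → Prop} {g : ρ → ρ'} {σ : ρ → ℕ}
    {σ' : ρ' → ℕ} (h : ∀ x, S x → σ' (g x) = σ x) {o : Op ρ} (ho : o.Uses S) :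
    (o.map g).eval I σ' = o.eval I σ := by
  cases o <;> simp_all [Op.map, Op.eval, Op.Uses]

/-- Transfers compiled programs from registers in `ℕ` to a finite type. Injectivity is asked only on
the registers in use, because `Fin.ofNat` is not injective globally. -/
theorem Exec.map {ρ ρ' : Type} [DecidableEq ρ] [DecidableEq ρ'] {I : HostInput G d} {B : ℕ}
    {S : ρ → Prop} {g : ρ → ρ'} (hg : Set.InjOn g {x | S x}) {p : Prog ρ} {σ τ : ρ → ℕ} {t : ℕ}
    (h : Exec I B p σ t τ) (hp : p.Uses S) {σ' : ρ' → ℕ} (hσ : ∀ x, S x → σ' (g x) = σ x) :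
    ∃ τ', Exec I B (p.map g) σ' t τ' ∧ ∀ x, S x → τ' (g x) = τ x := by
  induction h generalizing σ' with
  | skip σ => exact ⟨σ', .skip σ', hσ⟩
  | assign x o σ ho =>
    have he := Op.eval_map I hσ hp.2
    refine ⟨_, .assign (g x) (o.map g) σ' (he ▸ ho), fun y hy => ?_⟩
    rw [he, Function.update_apply, Function.update_apply, hσ y hy]
    exact if_congr (hg.eq_iff hy hp.1) rfl rfl
  | seq _ _ ih₁ ih₂ =>
    obtain ⟨τ', h1, h2⟩ := ih₁ hp.1 hσ
    obtain ⟨υ', h3, h4⟩ := ih₂ hp.2 h2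
    exact ⟨υ', .seq h1 h3, h4⟩
  | if_true hx _ ih =>
    obtain ⟨τ', h1, h2⟩ := ih hp.2.1 hσ
    exact ⟨τ', .if_true (by rwa [hσ _ hp.1]) h1, h2⟩
  | if_false hx _ ih =>
    obtain ⟨τ', h1, h2⟩ := ih hp.2.2 hσ
    exact ⟨τ', .if_false (by rwa [hσ _ hp.1]) h1, h2⟩
  | while_true hx _ _ ih₁ ih₂ =>
    obtain ⟨τ', h1, h2⟩ := ih₁ hp.2 hσ
    obtain ⟨υ', h3, h4⟩ := ih₂ hp h2
    exact ⟨υ', .while_true (by rwa [hσ _ hp.1]) h1 h3, h4⟩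
  | while_false hx => exact ⟨σ', .while_false (by rwa [hσ _ hp.1]), hσ⟩

theorem Op.exists_uses_lt (o : Op ℕ) : ∃ r, ∀ s ≥ r, o.Uses (· < s) := by
  cases o with
  | const a => exact ⟨0, fun _ _ => trivial⟩
  | size => exact ⟨0, fun _ _ => trivial⟩
  | copy x => exact ⟨x + 1, fun _ h => h⟩
  | outdegree x => exact ⟨x + 1, fun _ h => h⟩
  | add x y => exact ⟨x + y + 1, fun _ h => ⟨by lia, by lia⟩⟩
  | sub x y => exact ⟨x + y + 1, fun _ h => ⟨by lia, by lia⟩⟩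
  | mul x y => exact ⟨x + y + 1, fun _ h => ⟨by lia, by lia⟩⟩
  | div x y => exact ⟨x + y + 1, fun _ h => ⟨by lia, by lia⟩⟩
  | outNeighbour x y => exact ⟨x + y + 1, fun _ h => ⟨by lia, by lia⟩⟩

theorem Prog.exists_uses_lt (p : Prog ℕ) : ∃ r, ∀ s ≥ r, p.Uses (· < s) := by
  induction p with
  | skip => exact ⟨0, fun _ _ => trivial⟩
  | assign x o =>
    obtain ⟨r, hr⟩ := o.exists_uses_lt
    exact ⟨r + x + 1, fun s hs => ⟨by lia, hr s (by lia)⟩⟩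
  | seq p q ihp ihq =>
    obtain ⟨r, hr⟩ := ihp
    obtain ⟨r', hr'⟩ := ihq
    exact ⟨r + r', fun s hs => ⟨hr s (by lia), hr' s (by lia)⟩⟩
  | ifNZ x p q ihp ihq =>
    obtain ⟨r, hr⟩ := ihp
    obtain ⟨r', hr'⟩ := ihq
    exact ⟨r + r' + x + 1, fun s hs => ⟨by lia, hr s (by lia), hr' s (by lia)⟩⟩
  | whileNZ x p ih =>
    obtain ⟨r, hr⟩ := ih
    exact ⟨r + x + 1, fun s hs => ⟨by lia, hr s (by lia)⟩⟩

/-- An expression with at most three nested sums can be evaluated in cubic time and constant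
space. -/
theorem Expr.exists_prog (d : ℕ) (e : Expr ℕ) (hd : e.depth ≤ 3) :
    ∃ (r : ℕ) (P : Prog (Fin r)) (o : Fin r) (C w : ℕ),
      ∀ (n : ℕ) (G : SimpleGraph (Fin n)) (I : HostInput G d), ∃ (t : ℕ) (τ : Fin r → ℕ),
        Exec I (C * (n + 1) ^ w) P (fun _ => 0) t τ ∧ t ≤ C * (n ^ 3 + 1) ∧
        τ o = e.eval I fun _ => 0 := by
  obtain ⟨s, hs⟩ := e.exists_varsLT
  obtain ⟨R, hR⟩ := (e.compile s).exists_uses_lt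
  obtain ⟨C, w, hC⟩ := e.exists_bound_le d
  obtain ⟨C', hC'⟩ := e.exists_time_le
  let r := R + s
  -- One constant serves both the value bound and the time bound; the `8` comes from `(n + 1) ^ 3 ≤
  -- 8 * (n ^ 3 + 1)`.
  refine ⟨r + 1, (e.compile s).map (Fin.ofNat (r + 1)), Fin.ofNat (r + 1) s, C + 8 * C', w,
    fun n G I => ?_⟩
  obtain ⟨t, τ, hE, ht, hτ, -⟩ := e.runs_compile I (B := (C + 8 * C') * (n + 1) ^ w) hs le_rfl
    (σ := fun _ => 0) (fun _ _ => Nat.zero_le _)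
    ((hC n).trans (Nat.mul_le_mul_right _ (Nat.le_add_right _ _)))
  obtain ⟨τ', hE', hτ'⟩ := hE.map (S := (· < r + 1)) (g := Fin.ofNat (r + 1))
    (fun x hx y hy hxy => by
      have := congrArg Fin.val hxy
      simp only [Fin.ofNat] at this
      rwa [Nat.mod_eq_of_lt hx, Nat.mod_eq_of_lt hy] at this)
    (hR _ (by lia)) (σ' := fun _ => 0) (fun _ _ => rfl)
  refine ⟨t, τ', hE', ?_, (hτ' s (by lia)).trans hτ⟩
  calc t ≤ C' * (n + 1) ^ e.depth := ht.trans (hC' n)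
    _ ≤ C' * (n + 1) ^ 3 :=
      Nat.mul_le_mul_left _ (Nat.pow_le_pow_right (Nat.succ_pos n) hd)
    _ ≤ C' * (8 * (n ^ 3 + 1)) := by
      refine Nat.mul_le_mul_left _ ?_
      rcases Nat.eq_zero_or_pos n with rfl | hn
      · norm_num
      · have : (n + 1) ^ 3 ≤ (2 * n) ^ 3 := Nat.pow_le_pow_left (by lia) 3
        rw [mul_pow] at this
        lia
    _ = (8 * C') * (n ^ 3 + 1) := by ring
    _ ≤ (C + 8 * C') * (n ^ 3 + 1) := Nat.mul_le_mul_right _ (Nat.le_add_left _ _)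

end RAM

/-! ### Out-neighbours and expressible functions. -/

namespace HostInput

variable {n d : ℕ} {G : SimpleGraph (Fin n)}

/-- `y` is an out-neighbour of `x`. -/
def IsOut (I : HostInput G d) (x y : ℕ) : Prop :=
  ∃ i < I.outdegree x, I.outNeighbour x i = y

theorem outNeighbour_eq (I : HostInput G d) {x i : ℕ} (hx : x < n)
    (hi : i < (I.out ⟨x, hx⟩).length) : I.outNeighbour x i = (I.out ⟨x, hx⟩)[i] := by
  simp [outNeighbour, hx, hi]

theorem lt_of_lt_outdegree (I : HostInput G d) {x i : ℕ} (hi : i < I.outdegree x) :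
    ∃ hx : x < n, i < (I.out ⟨x, hx⟩).length := by
  by_cases hx : x < n
  · exact ⟨hx, by simpa [outdegree, hx] using hi⟩
  · simp [outdegree, hx] at hi

theorem outNeighbour_lt (I : HostInput G d) {x i : ℕ} (hi : i < I.outdegree x) :
    I.outNeighbour x i < n := by
  obtain ⟨hx, hi⟩ := I.lt_of_lt_outdegree hi
  rw [I.outNeighbour_eq hx hi]
  exact Fin.is_lt _

theorem outNeighbour_inj (I : HostInput G d) {x i j : ℕ} (hi : i < I.outdegree x)
    (hj : j < I.outdegree x) (h : I.outNeighbour x i = I.outNeighbour x j) : i = j := by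
  obtain ⟨hx, hi⟩ := I.lt_of_lt_outdegree hi
  obtain ⟨_, hj⟩ := I.lt_of_lt_outdegree hj
  rw [I.outNeighbour_eq hx hi, I.outNeighbour_eq hx hj] at h
  exact (I.nodup ⟨x, hx⟩).getElem_inj_iff.1 (Fin.ext h)

theorem isOut_val_iff (I : HostInput G d) {x y : Fin n} : I.IsOut x y ↔ y ∈ I.out x := by
  constructor
  · rintro ⟨i, hi, h⟩
    obtain ⟨hx, hi⟩ := I.lt_of_lt_outdegree hi
    rw [I.outNeighbour_eq hx hi] at h
    rw [← Fin.ext h]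
    exact List.getElem_mem _
  · intro h
    obtain ⟨i, hi, h⟩ := List.getElem_of_mem h
    exact ⟨i, by simpa [outdegree] using hi, by rw [I.outNeighbour_eq x.2 hi, ← h]⟩

-- Out-neighbour lists have no repetitions and at most `d` entries, so a sum over `n` vertices
-- becomes one over `d` indices.
open Classical in
theorem sum_isOut (I : HostInput G d) (y : ℕ) (g : ℕ → ℕ) :
    (∑ v ∈ Finset.range n, if I.IsOut y v then g v else 0) =
      ∑ i ∈ Finset.range d, if i < I.outdegree y then g (I.outNeighbour y i) else 0 := by
  rw [← Finset.sum_filter, ← Finset.sum_filter]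
  symm
  refine Finset.sum_nbij (I.outNeighbour y) ?_ ?_ ?_ fun _ _ => rfl
  · intro i hi
    have hi := (Finset.mem_filter.1 hi).2
    exact Finset.mem_filter.2 ⟨Finset.mem_range.2 (I.outNeighbour_lt hi), i, hi, rfl⟩
  · intro i hi j hj h
    exact I.outNeighbour_inj (Finset.mem_filter.1 hi).2 (Finset.mem_filter.1 hj).2 h
  · intro v hv
    obtain ⟨i, hi, h⟩ := (Finset.mem_filter.1 hv).2
    exact ⟨i, Finset.mem_filter.2 ⟨Finset.mem_range.2 (hi.trans_le (I.outdegree_le y)), hi⟩, h⟩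

end HostInput

namespace RAM

/-- A host graph together with an input representation. -/
def Host (d : ℕ) : Type := Σ (n : ℕ) (G : SimpleGraph (Fin n)), HostInput G d

/-- The function `F` of the host graph and of the values of some variables is the value of an
expression with at most `l` nested sums. -/
def Expressible {d : ℕ} {V : Type} [DecidableEq V] (l : ℕ) (F : Host d → (V → ℕ) → ℕ) : Prop :=
  ∃ e : Expr V, e.depth ≤ l ∧ ∀ J σ, e.eval J.2.2 σ = F J σ

namespace Expressible

variable {d l : ℕ} {V : Type} [DecidableEq V] {F F' : Host d → (V → ℕ) → ℕ}

theorem congr (h : Expressible l F) (hF : ∀ J σ, F J σ = F' J σ) : Expressible l F' := by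
  obtain ⟨e, he, h⟩ := h
  exact ⟨e, he, fun J σ => (h J σ).trans (hF J σ)⟩

theorem mono {m : ℕ} (h : Expressible l F) (hlm : l ≤ m) : Expressible m F := by
  obtain ⟨e, he, h⟩ := h
  exact ⟨e, he.trans hlm, h⟩

theorem const (a : ℕ) : Expressible l fun (_ : Host d) (_ : V → ℕ) => a :=
  ⟨.lit a, Nat.zero_le _, fun _ _ => rfl⟩

theorem var (x : V) : Expressible l fun (_ : Host d) (σ : V → ℕ) => σ x :=
  ⟨.var x, Nat.zero_le _, fun _ _ => rfl⟩

theorem deg (x : V) : Expressible l fun (J : Host d) (σ : V → ℕ) => J.2.2.outdegree (σ x) :=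
  ⟨.deg x, Nat.zero_le _, fun _ _ => rfl⟩

theorem bin (o : BinOp) (h : Expressible l F) (h' : Expressible l F') :
    Expressible l fun J σ => o.eval (F J σ) (F' J σ) := by
  obtain ⟨e, he, h⟩ := h
  obtain ⟨e', he', h'⟩ := h'
  exact ⟨.bin o e e', max_le he he', fun J σ => by rw [Expr.eval, h, h']⟩

theorem add (h : Expressible l F) (h' : Expressible l F') :
    Expressible l fun J σ => F J σ + F' J σ := bin .add h h'

theorem sub (h : Expressible l F) (h' : Expressible l F') :
    Expressible l fun J σ => F J σ - F' J σ := bin .sub h h'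

theorem mul (h : Expressible l F) (h' : Expressible l F') :
    Expressible l fun J σ => F J σ * F' J σ := bin .mul h h'

theorem div (h : Expressible l F) (h' : Expressible l F') :
    Expressible l fun J σ => F J σ / F' J σ := bin .div h h'

theorem bind (x y : V) (i : ℕ) (h : Expressible l F) :
    Expressible l fun J σ => F J (Function.update σ x (J.2.2.outNeighbour (σ y) i)) := by
  obtain ⟨e, he, h⟩ := h
  exact ⟨.bind x y i e, he, fun J σ => h _ _⟩

theorem sum (x : V) (h : Expressible l F) :
    Expressible (l + 1) fun J σ => ∑ v ∈ Finset.range J.1, F J (Function.update σ x v) := by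
  obtain ⟨e, he, h⟩ := h
  exact ⟨.sum x e, Nat.succ_le_succ he, fun J σ => Finset.sum_congr rfl fun v _ => h _ _⟩

theorem finset_sum {ι : Type*} (s : Finset ι) {F : ι → Host d → (V → ℕ) → ℕ}
    (h : ∀ i ∈ s, Expressible l (F i)) : Expressible l fun J σ => ∑ i ∈ s, F i J σ := by
  classical
  induction s using Finset.induction_on with
  | empty => exact (const 0).congr fun _ _ => Finset.sum_empty.symm
  | insert i s hi ih =>
    exact ((h i (Finset.mem_insert_self i s)).add
      (ih fun j hj => h j (Finset.mem_insert_of_mem hj))).congr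
      fun J σ => (Finset.sum_insert (f := fun i => F i J σ) hi).symm

theorem finset_prod {ι : Type*} (s : Finset ι) {F : ι → Host d → (V → ℕ) → ℕ}
    (h : ∀ i ∈ s, Expressible l (F i)) : Expressible l fun J σ => ∏ i ∈ s, F i J σ := by
  classical
  induction s using Finset.induction_on with
  | empty => exact (const 1).congr fun _ _ => Finset.prod_empty.symm
  | insert i s hi ih =>
    exact ((h i (Finset.mem_insert_self i s)).mul
      (ih fun j hj => h j (Finset.mem_insert_of_mem hj))).congr
      fun J σ => (Finset.prod_insert (f := fun i => F i J σ) hi).symm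

open Classical in
/-- A sum over the out-neighbours of a vertex needs no sum over all vertices. -/
theorem sum_isOut (x y : V) (h : Expressible l F) :
    Expressible l fun J σ => ∑ v ∈ Finset.range J.1,
      if J.2.2.IsOut (σ y) v then F J (Function.update σ x v) else 0 := by
  refine (finset_sum (Finset.range d) (F := fun i J σ =>
    -- With truncated subtraction this factor is the indicator of `i < outdegree`; it cancels the
    -- default value of `outNeighbour`.
    (1 - (i + 1 - J.2.2.outdegree (σ y))) *
      F J (Function.update σ x (J.2.2.outNeighbour (σ y) i))) fun i _ =>
    ((const 1).sub ((const (i + 1)).sub (deg y))).mul (bind x y i h)).congr fun J σ => ?_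
  rw [J.2.2.sum_isOut (σ y) fun v => F J (Function.update σ x v)]
  refine Finset.sum_congr rfl fun i _ => ?_
  split
  · rw [show 1 - (i + 1 - J.2.2.outdegree (σ y)) = 1 by lia, one_mul]
  · rw [show 1 - (i + 1 - J.2.2.outdegree (σ y)) = 0 by lia, zero_mul]

open Classical in
theorem isOut {x y : V} (hxy : x ≠ y) :
    Expressible l fun (J : Host d) (σ : V → ℕ) => if J.2.2.IsOut (σ x) (σ y) then 1 else 0 := by
  -- Counts the out-neighbours of `x` that equal `y`. The summand is the equality indicator, and `x`
  -- itself serves as bound variable, which leaves `σ y` intact because `x ≠ y`.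
  refine (sum_isOut (F := fun J σ => 1 - ((σ x - σ y) + (σ y - σ x))) x x
    ((const 1).sub (((var x).sub (var y)).add ((var y).sub (var x))))).congr fun J σ => ?_
  simp only [Function.update_self, Function.update_of_ne hxy.symm]
  split
  · rename_i h
    rw [Finset.sum_eq_single (σ y)]
    · simp [h]
    · intro v _ hv
      split
      · lia
      · rfl
    · intro hn
      obtain ⟨i, hi, hi'⟩ := h
      exact absurd (Finset.mem_range.2 (hi' ▸ J.2.2.outNeighbour_lt hi)) hn
  · rename_i h
    refine Finset.sum_eq_zero fun v _ => ?_
    split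
    · rename_i hv
      have : v ≠ σ y := by rintro rfl; exact h hv
      lia
    · rfl

end Expressible

/-! ### Sums over the values of a set of variables. -/

section SumOver

variable {V : Type} [Fintype V] [DecidableEq V] {n : ℕ}

open Classical in
/-- The assignments of numbers below `n` to the variables in `A` that agree with `σ` elsewhere. -/
noncomputable def assignments (n : ℕ) (A : Set V) (σ : V → ℕ) : Finset (V → ℕ) :=
  Fintype.piFinset fun v => if v ∈ A then Finset.range n else {σ v}

/-- The sum of `F` over all values below `n` of the variables in `A`. -/
noncomputable def sumOver (n : ℕ) (A : Set V) (F : (V → ℕ) → ℕ) (σ : V → ℕ) : ℕ :=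
  ∑ φ ∈ assignments n A σ, F φ

/-- The value of `F` does not depend on the variables in `A`. -/
def IndepOf (A : Set V) (F : (V → ℕ) → ℕ) : Prop :=
  ∀ σ τ : V → ℕ, (∀ v ∉ A, σ v = τ v) → F σ = F τ

theorem eq_of_mem_assignments {A : Set V} {σ φ : V → ℕ}
    (h : φ ∈ assignments n A σ) {v : V} (hv : v ∉ A) : φ v = σ v := by
  have := Fintype.mem_piFinset.1 h v
  rwa [if_neg hv, Finset.mem_singleton] at this

theorem sumOver_empty (F : (V → ℕ) → ℕ) (σ : V → ℕ) : sumOver n ∅ F σ = F σ := by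
  simp [sumOver, assignments, Fintype.piFinset_singleton]

theorem sumOver_insert {A : Set V} {a : V} (ha : a ∉ A) (F : (V → ℕ) → ℕ) (σ : V → ℕ) :
    sumOver n (insert a A) F σ =
      ∑ x ∈ Finset.range n, sumOver n A F (Function.update σ a x) := by
  unfold sumOver
  rw [← Finset.sum_fiberwise_of_maps_to (t := Finset.range n) (g := fun φ => φ a)]
  · refine Finset.sum_congr rfl fun x hx => Finset.sum_congr ?_ fun _ _ => rfl
    ext φ
    simp only [assignments, Finset.mem_filter, Fintype.mem_piFinset]
    constructor
    · rintro ⟨h, rfl⟩ v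
      have := h v
      by_cases hva : v = a
      · subst hva; simp [ha]
      · rw [Function.update_of_ne hva]
        by_cases hv : v ∈ A
        · rw [if_pos hv]
          rwa [if_pos (Set.mem_insert_of_mem a hv)] at this
        · rw [if_neg hv]
          rwa [if_neg (by simp [hva, hv])] at this
    · intro h
      have hφ : φ a = x := by simpa [ha] using h a
      refine ⟨fun v => ?_, hφ⟩
      by_cases hva : v = a
      · subst hva; simpa [hφ] using hx
      · have := h v
        rw [Function.update_of_ne hva] at this
        by_cases hv : v ∈ A
        · rw [if_pos (Set.mem_insert_of_mem a hv)]
          rwa [if_pos hv] at this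
        · rw [if_neg (by simp [hva, hv])]
          rwa [if_neg hv] at this
  · intro φ h
    simpa using Fintype.mem_piFinset.1 h a

theorem sumOver_congr {A : Set V} {F F' : (V → ℕ) → ℕ} (h : ∀ σ, F σ = F' σ) (σ : V → ℕ) :
    sumOver n A F σ = sumOver n A F' σ :=
  Finset.sum_congr rfl fun φ _ => h φ

theorem sumOver_union {A B : Set V} (h : Disjoint A B) (F : (V → ℕ) → ℕ) (σ : V → ℕ) :
    sumOver n (A ∪ B) F σ = sumOver n A (sumOver n B F) σ := by
  induction A, A.toFinite using Set.Finite.induction_on generalizing σ with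
  | empty => rw [Set.empty_union, sumOver_empty]
  | insert ha _ ih =>
    rw [Set.disjoint_insert_left] at h
    rw [Set.insert_union, sumOver_insert (by simp [ha, h.1]), sumOver_insert ha]
    exact Finset.sum_congr rfl fun x _ => ih h.2 _

theorem sumOver_mul {A : Set V} {F F' : (V → ℕ) → ℕ} (h : IndepOf A F) (σ : V → ℕ) :
    sumOver n A (fun σ => F σ * F' σ) σ = F σ * sumOver n A F' σ := by
  unfold sumOver
  rw [Finset.mul_sum]
  refine Finset.sum_congr rfl fun φ hφ => ?_
  rw [← h φ σ fun v hv => eq_of_mem_assignments hφ hv]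

theorem IndepOf.sumOver {B : Set V} {F : (V → ℕ) → ℕ} (h : IndepOf B F) (A : Set V) :
    IndepOf B (sumOver n A F) := by
  suffices ∀ σ τ : V → ℕ, (∀ v ∉ A ∪ B, σ v = τ v) →
      RAM.sumOver n A F σ = RAM.sumOver n A F τ from
    fun σ τ hστ => this σ τ fun v hv => hστ v fun hvB => hv (.inr hvB)
  induction A, A.toFinite using Set.Finite.induction_on with
  | empty =>
    intro σ τ hστ
    rw [sumOver_empty, sumOver_empty]
    exact h σ τ fun v hv => hστ v (by simpa using hv)
  | @insert a A ha _ ih =>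
    intro σ τ hστ
    rw [sumOver_insert ha, sumOver_insert ha]
    refine Finset.sum_congr rfl fun x _ => ih _ _ fun v hv => ?_
    simp only [Function.update_apply]
    split
    · rfl
    · refine hστ v ?_
      rintro (hvA | hvB)
      · rcases hvA with rfl | hvA
        · contradiction
        · exact hv (.inl hvA)
      · exact hv (.inr hvB)

/-- The distributive law: each factor is constant on the blocks of the others, so the sum of
products splits. It is what makes disconnected parts cost only the maximum of their depths. -/
theorem sumOver_biUnion {ι : Type*} (T : Finset ι) {f : ι → Set V} {F : ι → (V → ℕ) → ℕ}
    (hf : Pairwise fun i j => Disjoint (f i) (f j)) (hF : ∀ i j, i ≠ j → IndepOf (f j) (F i))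
    (σ : V → ℕ) :
    sumOver n (⋃ i ∈ T, f i) (fun σ => ∏ i ∈ T, F i σ) σ = ∏ i ∈ T, sumOver n (f i) (F i) σ := by
  classical
  induction T using Finset.induction_on generalizing σ with
  | empty => simp [sumOver_empty]
  | insert i T hi ih =>
    have hne : ∀ j ∈ T, i ≠ j := fun j hj e => hi (e ▸ hj)
    have hind : IndepOf (⋃ j ∈ T, f j) (F i) := by
      clear ih
      have : ∀ T : Finset ι, (∀ j ∈ T, i ≠ j) → ∀ σ τ : V → ℕ,
          (∀ v ∉ ⋃ j ∈ T, f j, σ v = τ v) → F i σ = F i τ := by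
        intro T
        induction T using Finset.induction_on with
        | empty =>
          intro _ σ τ h
          rw [funext fun v => h v (by simp)]
        | insert k T hk ih =>
          intro hne σ τ h
          rw [hF i k (hne k (Finset.mem_insert_self k T)) σ (fun v => if v ∈ f k then τ v else σ v)
            fun v hv => by rw [if_neg hv]]
          refine ih (fun j hj => hne j (Finset.mem_insert_of_mem hj)) _ _ fun v hv => ?_
          split
          · rfl
          · refine h v ?_
            rw [Finset.set_biUnion_insert]
            exact fun h => h.elim ‹_› hv
      exact this T hne
    have hdisj : Disjoint (f i) (⋃ j ∈ T, f j) := by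
      simp only [Set.disjoint_iUnion_right]
      exact fun j hj => hf (hne j hj)
    rw [Finset.set_biUnion_insert, sumOver_union hdisj, Finset.prod_insert hi]
    have step : ∀ σ, sumOver n (⋃ j ∈ T, f j) (fun σ => ∏ j ∈ insert i T, F j σ) σ =
        (∏ j ∈ T, sumOver n (f j) (F j) σ) * F i σ := by
      intro σ
      simp only [Finset.prod_insert hi]
      rw [sumOver_mul hind, ih, mul_comm]
    rw [sumOver_congr step, sumOver_mul, mul_comm]
    intro σ τ hστ
    exact Finset.prod_congr rfl fun j hj => (hF j i (hne j hj).symm).sumOver _ σ τ hστ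

end SumOver

end RAM

/-! ### Homomorphism counts along elimination forests. -/

namespace RAM

section HomWeight

variable {V : Type} [Fintype V] {d : ℕ} {D : Digraph V}

open Classical in
/-- The indicator of the assignments that map each edge of `D` that starts in `A` to an edge of the
oriented host graph. -/
noncomputable def homWeight (D : Digraph V) (A : Set V) (J : Host d) (σ : V → ℕ) : ℕ :=
  if ∀ u ∈ A, ∀ v, D.Adj u v → J.2.2.IsOut (σ u) (σ v) then 1 else 0

/-- Each edge is charged to its tail, so edges between `A` and `B` are not lost; overlaps are
harmless for indicators. -/
theorem homWeight_union (A B : Set V) (J : Host d) (σ : V → ℕ) :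
    homWeight D (A ∪ B) J σ = homWeight D A J σ * homWeight D B J σ := by
  classical
  simp only [homWeight, ite_zero_mul_ite_zero, one_mul]
  congr 1
  simp only [Set.mem_union, or_imp, forall_and]

theorem homWeight_biUnion {ι : Type*} (T : Finset ι) (f : ι → Set V) (J : Host d) (σ : V → ℕ) :
    homWeight D (⋃ i ∈ T, f i) J σ = ∏ i ∈ T, homWeight D (f i) J σ := by
  classical
  induction T using Finset.induction_on with
  | empty => simp [homWeight]
  | insert i T hi ih => rw [Finset.set_biUnion_insert, homWeight_union, ih, Finset.prod_insert hi]

theorem indepOf_homWeight {A B : Set V} (J : Host d) (hdisj : ∀ u ∈ A, u ∉ B)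
    (h : ∀ u ∈ A, ∀ v, D.Adj u v → v ∉ B) : IndepOf B (homWeight D A J) := by
  classical
  intro σ τ hστ
  simp only [homWeight]
  refine if_congr (forall_congr' fun u => forall_congr' fun hu => forall_congr' fun v =>
    forall_congr' fun huv => ?_) rfl rfl
  rw [hστ u (hdisj u hu), hστ v (h u hu v huv)]

variable [DecidableEq V]

theorem expressible_homWeight (hD : ∀ v, ¬ D.Adj v v) (l : ℕ) (A : Set V) :
    Expressible l (homWeight (d := d) D A) := by
  classical
  have h : ∀ u v, Expressible l fun (J : Host d) (σ : V → ℕ) =>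
      if u ∈ A → D.Adj u v → J.2.2.IsOut (σ u) (σ v) then 1 else 0 := by
    intro u v
    by_cases hu : u ∈ A
    · by_cases huv : D.Adj u v
      · have hne : u ≠ v := by rintro rfl; exact hD u huv
        exact (Expressible.isOut hne).congr fun J σ => by simp [hu, huv]
      · exact (Expressible.const 1).congr fun J σ => by simp [huv]
    · exact (Expressible.const 1).congr fun J σ => by simp [hu]
  refine (Expressible.finset_prod Finset.univ fun u _ =>
    Expressible.finset_prod Finset.univ fun v _ => h u v).congr fun J σ => ?_
  simp only [Fintype.prod_boole, homWeight]
  exact if_congr ⟨fun h u hu v => h u v hu, fun h u v hu => h u hu v⟩ rfl rfl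

/-- If `F` vanishes unless the edges of `D` that start in the reach of `s` are respected, then the
sum over the vertices that are reachable from `s`, apart from a set `B` that contains `s`, runs
through out-neighbours only. -/
theorem expressible_sumOver_reachIn {l : ℕ} {A : Set V} {s : V}
    {F : Host d → (V → ℕ) → ℕ} (hF : Expressible l F)
    (h0 : ∀ J σ, ∀ u ∈ D.reachIn A s, ∀ v, D.Adj u v → ¬ J.2.2.IsOut (σ u) (σ v) → F J σ = 0)
    (B : Set V) (hsB : s ∈ B) (hB : B ⊆ D.reachIn A s) :
    Expressible l fun J => sumOver J.1 (D.reachIn A s \ B) (F J) := by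
  classical
  induction h : (D.reachIn A s \ B).ncard using Nat.strong_induction_on generalizing B with
  | _ m ih =>
    rcases (D.reachIn A s \ B).eq_empty_or_nonempty with he | ⟨w, hw⟩
    · rw [he]
      exact hF.congr fun J σ => (sumOver_empty _ _).symm
    -- As `s ∈ B` reaches everything, some edge `u → v` leaves `B`. The value of `u` is then already
    -- fixed, and only its out-neighbours are candidates for `v`.
    obtain ⟨u, hu, v, hv, hvB, huv⟩ :
        ∃ u ∈ B, ∃ v ∈ D.reachIn A s, v ∉ B ∧ D.Adj u v := by
      by_contra! hno
      refine hw.2 ?_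
      have hwr : Relation.ReflTransGen (fun x y => x ∈ A ∧ y ∈ A ∧ D.Adj x y) s w := hw.1
      clear hw
      induction hwr with
      | refl => exact hsB
      | tail hb hbc ihb =>
        by_contra hc
        exact hno _ ihb _ (hb.tail hbc) hc hbc.2.2
    have hset : D.reachIn A s \ B = insert v (D.reachIn A s \ insert v B) := by
      ext x
      by_cases hx : x = v
      · subst hx; simp [hv, hvB]
      · simp [hx]
    have hlt : (D.reachIn A s \ insert v B).ncard < m := by
      rw [← h, hset, Set.ncard_insert_of_notMem (by simp) (Set.toFinite _)]
      exact Nat.lt_succ_self _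
    have ih' := ih _ hlt (insert v B) (Set.mem_insert_of_mem v hsB)
      (Set.insert_subset hv hB) rfl
    refine (ih'.sum_isOut v u).congr fun J σ => ?_
    rw [hset, sumOver_insert (by simp)]
    refine Finset.sum_congr rfl fun x _ => ?_
    split
    · rfl
    · rename_i hx
      symm
      refine Finset.sum_eq_zero fun φ hφ => h0 J φ u (hB hu) v huv ?_
      have huv' : u ≠ v := by rintro rfl; exact hvB hu
      rw [eq_of_mem_assignments hφ (by simp [hu]), eq_of_mem_assignments hφ (by simp),
        Function.update_self, Function.update_of_ne huv']
      exact hx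

/-- Homomorphism counts are expressible with as many nested sums as the depth of an elimination
forest. -/
theorem expressible_of_elimForest (hD : ∀ v, ¬ D.Adj v v) {A : Set V} (T : D.ElimForest A) {l : ℕ}
    (hl : T.depth ≤ l) :
    Expressible l fun (J : Host d) => sumOver J.1 A (homWeight D A J) := by
  classical
  induction T generalizing l with
  | empty A hA =>
    subst hA
    exact (expressible_homWeight hD l ∅).congr fun J σ => (sumOver_empty _ _).symm
  | union A hne hA T ih =>
    have := Fintype.ofFinite (D.underlyingOn A).ConnectedComponent
    have hA' : A = ⋃ c ∈ (Finset.univ : Finset (D.underlyingOn A).ConnectedComponent),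
        Subtype.val '' c.supp := by
      ext v
      simp only [Finset.mem_univ, Set.iUnion_true, Set.mem_iUnion]
      exact ⟨fun hv => ⟨(D.underlyingOn A).connectedComponentMk ⟨v, hv⟩, ⟨v, hv⟩, rfl, rfl⟩,
        fun ⟨c, hc⟩ => Subtype.coe_image_subset _ _ hc⟩
    have hdisj : Pairwise fun c c' : (D.underlyingOn A).ConnectedComponent =>
        Disjoint (Subtype.val '' c.supp : Set V) (Subtype.val '' c'.supp) := by
      intro c c' hcc
      exact Set.disjoint_image_of_injective Subtype.val_injective
        (SimpleGraph.pairwise_disjoint_supp_connectedComponent _ hcc)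
    refine (Expressible.finset_prod Finset.univ fun c _ =>
      ih c ((le_iSup (fun c => (T c).depth) c).trans (by simpa only [Digraph.ElimForest.depth]
        using hl))).congr fun J σ => ?_
    rw [← sumOver_biUnion Finset.univ hdisj, ← hA']
    · refine sumOver_congr (fun σ => ?_) σ
      rw [← homWeight_biUnion, ← hA']
    · intro c c' hcc
      have hnot : ∀ u ∈ (Subtype.val '' c.supp : Set V), u ∉ (Subtype.val '' c'.supp : Set V) :=
        fun u hu hu' => Set.disjoint_left.1 (hdisj hcc) hu hu'
      refine indepOf_homWeight J hnot fun u hu v huv hv => ?_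
      exact hnot v (Digraph.image_supp_closed c u hu v (Subtype.coe_image_subset _ _ hv)
        (.inl huv)) hv
  | root A hA s hs T ih =>
    have hsub : D.reachIn A s ⊆ A := by
      intro v hv
      rcases Relation.ReflTransGen.cases_tail hv with h | ⟨_, _, h⟩
      · exact h ▸ hs.1
      · exact h.2.1
    have hpos : l ≠ 0 := by
      rintro rfl
      simp [Digraph.ElimForest.depth] at hl
    obtain ⟨l, rfl⟩ := Nat.exists_eq_succ_of_ne_zero hpos
    have hl' : T.depth ≤ l := by
      simp only [Digraph.ElimForest.depth, Nat.succ_eq_add_one, Nat.cast_add, Nat.cast_one] at hl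
      exact (ENat.add_le_add_iff_right ENat.one_ne_top).1 hl
    -- Edges may run from the remainder into the reach of `s` but not back. So the first factor is
    -- independent of the remaining variables, while the inner sum is evaluated with the images of
    -- the reach fixed.
    have hF : Expressible l fun (J : Host d) σ => homWeight D (D.reachIn A s) J σ *
        sumOver J.1 (A \ D.reachIn A s) (homWeight D (A \ D.reachIn A s) J) σ :=
      (expressible_homWeight hD l _).mul (ih hl')
    have hself : s ∈ D.reachIn A s := Relation.ReflTransGen.refl
    have h1 := expressible_sumOver_reachIn hF (fun J σ u hu v huv hn => by
      have : homWeight D (D.reachIn A s) J σ = 0 := if_neg fun h => hn (h u hu v huv)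
      rw [this, zero_mul]) {s} rfl (by simpa using hself)
    -- The image of the root is the only one that ranges over all vertices: this adds one level of
    -- nesting.
    refine (h1.sum s).congr fun J σ => ?_
    rw [← sumOver_insert (by simp)]
    have e1 : insert s (D.reachIn A s \ {s}) = D.reachIn A s := by
      ext x
      by_cases hx : x = s
      · subst hx; simp [hself]
      · simp [hx]
    have e2 : A = D.reachIn A s ∪ A \ D.reachIn A s := (Set.union_sdiff_cancel hsub).symm
    rw [e1]
    conv_rhs => rw [e2, sumOver_union Set.disjoint_sdiff_right]
    refine sumOver_congr (fun σ => ?_) σ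
    rw [← sumOver_mul]
    · exact sumOver_congr (fun σ => by rw [← homWeight_union, ← e2]) σ
    · refine indepOf_homWeight J (fun u hu h => h.2 hu) fun u hu v huv hv => ?_
      exact hv.2 (Relation.ReflTransGen.tail hu ⟨hsub hu, hv.1, huv⟩)

open Classical in
/-- The number of homomorphisms from `D` to the oriented host graph. -/
noncomputable def homCount (D : Digraph V) (J : Host d) : ℕ :=
  (Finset.univ.filter fun φ : V → Fin J.1 =>
    ∀ u v, D.Adj u v → J.2.2.IsOut (φ u) (φ v)).card

theorem sumOver_univ (J : Host d) (F : (V → ℕ) → ℕ) (σ : V → ℕ) :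
    sumOver J.1 Set.univ F σ = ∑ φ : V → Fin J.1, F fun v => φ v := by
  symm
  refine Finset.sum_bij (fun φ _ v => (φ v : ℕ)) ?_ ?_ ?_ fun _ _ => rfl
  · intro φ _
    simp [assignments]
  · intro φ _ ψ _ h
    exact funext fun v => Fin.ext (congrFun h v)
  · intro φ hφ
    have h : ∀ v, φ v < J.1 := by simpa [assignments] using hφ
    exact ⟨fun v => ⟨φ v, h v⟩, Finset.mem_univ _, rfl⟩

theorem sumOver_homWeight (J : Host d) (σ : V → ℕ) :
    sumOver J.1 Set.univ (homWeight D Set.univ J) σ = homCount D J := by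
  classical
  rw [sumOver_univ, homCount, Finset.card_filter]
  exact Finset.sum_congr rfl fun φ _ => by
    unfold homWeight
    congr 1
    simp only [Set.mem_univ, true_imp_iff]

/-- A closed walk would be mapped to a closed walk of the acyclic orientation. -/
theorem homCount_eq_zero (hD : ¬ D.IsDAG) (J : Host d) : homCount D J = 0 := by
  classical
  rw [homCount, Finset.card_eq_zero]
  refine Finset.filter_eq_empty_iff.2 fun φ _ h => hD fun v hv => ?_
  refine J.2.2.acyclic (φ v) (Relation.TransGen.lift φ (fun a b hab => ?_) _ _ hv)
  exact J.2.2.isOut_val_iff.1 (h a b hab)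

/-- The treedepth bound enters the counting here: depth three becomes three nested sums. -/
theorem expressible_homCount (hV : Nat.card V ≤ 9) (D : Digraph V) :
    Expressible 3 fun (J : Host d) (_ : ℕ → ℕ) => homCount D J := by
  by_cases hD : D.IsDAG
  swap
  · exact (Expressible.const 0).congr fun J _ => (homCount_eq_zero hD J).symm
  have hdtd := hD.dagTreedepth_le_three hV
  obtain ⟨T, hT⟩ : ∃ T : D.ElimForest Set.univ, T.depth ≤ (3 : ℕ) := by
    by_contra! h
    have h4 : ((3 : ℕ) + 1 : ℕ∞) ≤ D.dagTreedepth :=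
      le_iInf fun T => Order.add_one_le_of_lt (h T)
    have := h4.trans hdtd
    norm_num at this
  obtain ⟨e, he, h⟩ := expressible_of_elimForest (d := d)
    (fun v hv => hD v (.single hv)) T hT
  let g : V → ℕ := fun v => Fintype.equivFin V v
  have hg : Function.Injective g :=
    fun a b hab => (Fintype.equivFin V).injective (Fin.ext hab)
  exact ⟨e.map g, (e.depth_map g).le.trans he, fun J σ => by
    rw [Expr.eval_map hg]; exact (h J _).trans (sumOver_homWeight J _)⟩

end HomWeight

end RAM

/-! ### Degenerate graphs have input representations. -/

namespace SimpleGraph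

variable {n d : ℕ} {G : SimpleGraph (Fin n)}

/-- The vertices of a degenerate graph can be ranked so that every vertex has few neighbours of
smaller rank. -/
theorem IsDegenerate.exists_rank (hG : G.IsDegenerate d) (S : Finset (Fin n)) :
    ∃ f : Fin n → ℕ, Set.InjOn f S ∧
      ∀ v ∈ S, {u | u ∈ S ∧ G.Adj v u ∧ f u < f v}.ncard ≤ d := by
  classical
  induction hk : S.card generalizing S with
  | zero =>
    rw [Finset.card_eq_zero] at hk
    subst hk
    exact ⟨fun _ => 0, by simp, by simp⟩
  | succ k ih =>
    have hne : S.Nonempty := Finset.card_pos.1 (by lia)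
    let K : G.Subgraph := (⊤ : G.Subgraph).induce (S : Set (Fin n))
    obtain ⟨v, hv, hdeg⟩ := hG K hne
    have hv : v ∈ S := hv
    obtain ⟨f, hf, hfd⟩ := ih (S.erase v) (by rw [Finset.card_erase_of_mem hv, hk]; rfl)
    -- A vertex of small degree in `G[S]` is ranked above all others; the sum plus one exceeds every
    -- old rank.
    refine ⟨Function.update f v (∑ u, f u + 1), ?_, ?_⟩
    · have hlt : ∀ u, f u < ∑ u, f u + 1 := fun u =>
        Nat.lt_succ_of_le (Finset.single_le_sum (f := f) (fun _ _ => Nat.zero_le _)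
          (Finset.mem_univ u))
      intro a ha b hb hab
      by_cases hav : a = v
      · by_cases hbv : b = v
        · rw [hav, hbv]
        · subst hav
          rw [Function.update_self, Function.update_of_ne hbv] at hab
          exact absurd (hlt b) (by lia)
      · by_cases hbv : b = v
        · subst hbv
          rw [Function.update_self, Function.update_of_ne hav] at hab
          exact absurd (hlt a) (by lia)
        · rw [Function.update_of_ne hav, Function.update_of_ne hbv] at hab
          exact hf (Finset.mem_erase.2 ⟨hav, ha⟩) (Finset.mem_erase.2 ⟨hbv, hb⟩) hab
    · intro a ha
      by_cases hav : a = v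
      · subst hav
        refine (Set.ncard_le_ncard (t := K.neighborSet a) ?_ (Set.toFinite _)).trans ?_
        · rintro u ⟨hu, hau, -⟩
          exact ⟨ha, hu, hau⟩
        · rwa [← Nat.cast_le (α := ℕ∞), (Set.toFinite _).cast_ncard_eq]
      · refine le_trans (Set.ncard_le_ncard ?_ (Set.toFinite _))
          (hfd a (Finset.mem_erase.2 ⟨hav, ha⟩))
        rintro u ⟨hu, hau, hlt⟩
        rw [Function.update_of_ne hav] at hlt
        by_cases huv : u = v
        · subst huv
          rw [Function.update_self] at hlt
          have := Finset.single_le_sum (f := f) (fun _ _ => Nat.zero_le _) (Finset.mem_univ a)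
          lia
        · rw [Function.update_of_ne huv] at hlt
          exact ⟨Finset.mem_erase.2 ⟨huv, hu⟩, hau, hlt⟩

/-- Every edge is oriented towards its end of smaller rank, so ranks decrease along directed walks.
-/
theorem IsDegenerate.nonempty_hostInput (hG : G.IsDegenerate d) : Nonempty (HostInput G d) := by
  classical
  obtain ⟨f, hf, hd⟩ := hG.exists_rank Finset.univ
  let N : Fin n → Finset (Fin n) := fun v => {u | G.Adj v u ∧ f u < f v}
  refine ⟨⟨fun v => (N v).toList, fun v => Finset.nodup_toList _, fun v => ?_, fun u v => ?_,
    fun v hv => ?_⟩⟩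
  · rw [Finset.length_toList, ← Set.ncard_coe_finset]
    refine le_trans (Set.ncard_le_ncard ?_ (Set.toFinite _)) (hd v (Finset.mem_univ v))
    intro u hu
    have := (Finset.mem_filter.1 (Finset.mem_coe.1 hu)).2
    exact ⟨Finset.mem_univ u, this⟩
  · simp only [Finset.mem_toList, N, Finset.mem_filter_univ]
    constructor
    · intro h
      rcases lt_trichotomy (f u) (f v) with hlt | heq | hgt
      · exact .inr ⟨h.symm, hlt⟩
      · exact absurd (hf (by simp) (by simp) heq) h.ne
      · exact .inl ⟨h, hgt⟩
    · rintro (h | h)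
      · exact h.1
      · exact h.1.symm
  · have : ∀ a b, Relation.TransGen (fun x y => y ∈ (N x).toList) a b → f b < f a := by
      intro a b h
      induction h with
      | single h =>
        simp only [Finset.mem_toList, N, Finset.mem_filter_univ] at h
        exact h.2
      | tail _ h ih =>
        simp only [Finset.mem_toList, N, Finset.mem_filter_univ] at h
        exact h.2.trans ih
    exact lt_irrefl _ (this v v hv)

end SimpleGraph

/-! ### From induced subgraphs to homomorphism counts. -/

namespace HostInput

variable {n d : ℕ} {G : SimpleGraph (Fin n)}

theorem adj_iff_isOut (I : HostInput G d) (u v : Fin n) :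
    G.Adj u v ↔ I.IsOut u v ∨ I.IsOut v u := by
  rw [I.isOut_val_iff, I.isOut_val_iff, I.adj_iff]

theorem not_isOut_of_isOut (I : HostInput G d) {u v : Fin n} (h : I.IsOut u v) :
    ¬ I.IsOut v u := by
  rw [I.isOut_val_iff] at *
  exact fun h' => I.acyclic u (.tail (.single h) h')

end HostInput

/-- An embedding of `H` is a vertex set that induces a copy of `H` together with an isomorphism. -/
theorem indCount_mul_card_aut {W V : Type*} [Finite W] [Finite V] (H : SimpleGraph W)
    (G : SimpleGraph V) : indCount H G * Nat.card (H ≃g H) = Nat.card (H ↪g G) := by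
  let X := {S : Set V // Nonempty (G.induce S ≃g H)}
  let F : (Σ S : X, H ≃g G.induce S.1) → (H ↪g G) := fun p =>
    (SimpleGraph.Embedding.induce p.1.1).comp p.2.toEmbedding
  have hrange : ∀ p, Set.range (F p) = p.1.1 := by
    rintro ⟨⟨S, hS⟩, i⟩
    ext x
    constructor
    · rintro ⟨w, rfl⟩
      exact (i w).2
    · intro hx
      exact ⟨i.symm ⟨x, hx⟩, by simp [F]⟩
  have hinj : Function.Injective F := by
    intro p q h
    have hS : p.1.1 = q.1.1 := by rw [← hrange p, ← hrange q, h]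
    obtain ⟨⟨S, hS⟩, i⟩ := p
    obtain ⟨⟨T, hT⟩, j⟩ := q
    obtain rfl : S = T := hS
    obtain rfl : i = j := RelIso.ext fun w => Subtype.ext (DFunLike.congr_fun h w)
    rfl
  have hsurj : Function.Surjective F := by
    intro f
    let i : H ≃g G.induce (Set.range f) :=
      { toEquiv := Equiv.ofInjective f f.injective
        map_rel_iff' := f.map_adj_iff }
    exact ⟨⟨⟨Set.range f, ⟨i.symm⟩⟩, i⟩, by ext; rfl⟩
  have hfin : ∀ S : X, Finite (H ≃g G.induce S.1) := fun S => DFunLike.finite _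
  have hcard : ∀ S : X, Nat.card (H ≃g G.induce S.1) = Nat.card (H ≃g H) := by
    rintro ⟨S, ⟨j⟩⟩
    exact Nat.card_congr
      { toFun := fun i => i.trans j
        invFun := fun i => i.trans j.symm
        left_inv := fun i => by ext; simp
        right_inv := fun i => by ext; simp }
  have := Fintype.ofFinite X
  rw [← Nat.card_congr (Equiv.ofBijective F ⟨hinj, hsurj⟩), Nat.card_sigma]
  simp only [hcard, Finset.sum_const, smul_eq_mul, Finset.card_univ, ← Nat.card_eq_fintype_card]
  rfl

namespace RAM

variable {d k : ℕ}

section Constraints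

variable {W : Type} [Fintype W] [DecidableEq W]

open Classical in
/-- The number of maps to the host graph that identify the pairs related by `r` and send the pairs
related by `E` to edges of the oriented host graph. -/
noncomputable def constraintCount (r E : W → W → Prop) (J : Host d) : ℕ :=
  (Finset.univ.filter fun φ : W → Fin J.1 =>
    (∀ u v, r u v → φ u = φ v) ∧ ∀ u v, E u v → J.2.2.IsOut (φ u) (φ v)).card

/-- Maps identifying the `r`-related pairs are maps on `Quot r`, which has no more vertices than
`W`. Loops or cycles created by the quotient are allowed, since `expressible_homCount` covers every
digraph. -/
theorem expressible_constraintCount (hW : Nat.card W ≤ 9) (r E : W → W → Prop) :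
    Expressible 3 fun (J : Host d) (_ : ℕ → ℕ) => constraintCount r E J := by
  classical
  have : Fintype (Quot r) := Fintype.ofFinite _
  let D : Digraph (Quot r) :=
    { Adj := fun x y => ∃ u v, E u v ∧ Quot.mk r u = x ∧ Quot.mk r v = y }
  have hcard : Nat.card (Quot r) ≤ 9 :=
    (Nat.card_le_card_of_surjective _ Quot.mk_surjective).trans hW
  refine (expressible_homCount hcard D).congr fun J _ => ?_
  unfold homCount constraintCount
  refine Finset.card_bij (fun ψ _ w => ψ (Quot.mk r w)) ?_ ?_ ?_
  · intro ψ hψ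
    simp only [Finset.mem_filter_univ] at hψ ⊢
    exact ⟨fun u v huv => congrArg ψ (Quot.sound huv),
      fun u v huv => hψ _ _ ⟨u, v, huv, rfl, rfl⟩⟩
  · intro ψ _ ψ' _ h
    funext x
    induction x using Quot.ind with
    | mk w => exact congrFun h w
  · intro φ hφ
    simp only [Finset.mem_filter_univ] at hφ
    obtain ⟨h1, h2⟩ := hφ
    refine ⟨Quot.lift φ h1, ?_, rfl⟩
    simp only [Finset.mem_filter_univ]
    rintro _ _ ⟨u, v, huv, rfl, rfl⟩
    exact h2 u v huv

end Constraints

/-- The function `F` of the host graph is a difference of two expressible functions. -/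
def ExpressibleInt (l : ℕ) (F : Host d → ℤ) : Prop :=
  ∃ P Q : Host d → ℕ, Expressible l (fun J (_ : ℕ → ℕ) => P J) ∧
    Expressible l (fun J (_ : ℕ → ℕ) => Q J) ∧ ∀ J, F J = P J - Q J

theorem Expressible.const_mul_int {l : ℕ} {P : Host d → ℕ}
    (h : Expressible l fun J (_ : ℕ → ℕ) => P J) (c : ℤ) :
    ExpressibleInt l fun J => c * (P J : ℤ) := by
  rcases Int.eq_nat_or_neg c with ⟨a, rfl | rfl⟩
  · exact ⟨fun J => a * P J, fun _ => 0, (const a).mul h, const 0, fun J => by simp⟩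
  · exact ⟨fun _ => 0, fun J => a * P J, const 0, (const a).mul h, fun J => by simp⟩

theorem ExpressibleInt.finset_sum {l : ℕ} {ι : Type*} (s : Finset ι) {F : ι → Host d → ℤ}
    (h : ∀ i, ExpressibleInt l (F i)) : ExpressibleInt l fun J => ∑ i ∈ s, F i J := by
  choose P Q hP hQ hF using h
  exact ⟨fun J => ∑ i ∈ s, P i J, fun J => ∑ i ∈ s, Q i J,
    Expressible.finset_sum s fun i _ => hP i, Expressible.finset_sum s fun i _ => hQ i,
    fun J => by simp [hF]⟩

/-- The relations between the images of a pair of vertices into which induced embeddings are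
expanded. -/
def pairRel (J : Host d) (a : Fin 4) (x y : Fin J.1) : Prop :=
  ![J.2.2.IsOut x y, J.2.2.IsOut y x, x = y, True] a

open Classical in
/-- The coefficients of the expansion of induced embeddings. -/
noncomputable def pairCoeff (H : SimpleGraph (Fin k)) (u v : Fin k) (a : Fin 4) : ℤ :=
  if H.Adj u v then ![1, 1, 0, 0] a else ![-1, -1, -1, 1] a

-- The relations `x → y`, `y → x` and `x = y` exclude one another by acyclicity. Adjacency is the
-- sum of the first two indicators, and being distinct and non-adjacent is one minus all three.
open Classical in
theorem pair_expansion (H : SimpleGraph (Fin k)) (J : Host d) (u v : Fin k) (x y : Fin J.1) :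
    (if x ≠ y ∧ (J.2.1.Adj x y ↔ H.Adj u v) then 1 else 0 : ℤ) =
      ∑ a, pairCoeff H u v a * if pairRel J a x y then 1 else 0 := by
  have h1 := J.2.2.adj_iff_isOut x y
  have h2 : J.2.2.IsOut x y → ¬ J.2.2.IsOut y x := J.2.2.not_isOut_of_isOut
  have h3 : J.2.1.Adj x y → x ≠ y := fun h => h.ne
  simp only [Fin.sum_univ_four, pairCoeff, pairRel]
  by_cases hH : H.Adj u v <;> by_cases ho : J.2.2.IsOut x y <;>
    by_cases ho' : J.2.2.IsOut y x <;> by_cases hxy : x = y <;> simp_all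

/-- The pairs of distinct vertices. -/
abbrev Pairs (k : ℕ) : Type := {p : Fin k × Fin k // p.1 < p.2}

open Classical in
theorem card_embedding {n : ℕ} (H : SimpleGraph (Fin k)) (G : SimpleGraph (Fin n)) :
    Nat.card (H ↪g G) = (Finset.univ.filter fun φ : Fin k → Fin n =>
      ∀ p : Pairs k, φ p.1.1 ≠ φ p.1.2 ∧
        (G.Adj (φ p.1.1) (φ p.1.2) ↔ H.Adj p.1.1 p.1.2)).card := by
  rw [← Fintype.card_subtype, ← Nat.card_eq_fintype_card]
  refine Nat.card_congr (Equiv.ofBijective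
    (fun f => ⟨f, fun p => ⟨fun h => p.2.ne (f.injective h), f.map_adj_iff⟩⟩) ⟨?_, ?_⟩)
  · intro f g h
    exact DFunLike.coe_injective (congrArg Subtype.val h)
  · rintro ⟨φ, hφ⟩
    have hinj : Function.Injective φ := by
      intro u v huv
      rcases lt_trichotomy u v with h | h | h
      · exact absurd huv (hφ ⟨(u, v), h⟩).1
      · exact h
      · exact absurd huv.symm (hφ ⟨(v, u), h⟩).1
    refine ⟨⟨⟨φ, hinj⟩, ?_⟩, rfl⟩
    intro u v
    rcases lt_trichotomy u v with h | h | h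
    · exact (hφ ⟨(u, v), h⟩).2
    · subst h; simp
    · rw [G.adj_comm, H.adj_comm]
      exact (hφ ⟨(v, u), h⟩).2

/-- Multiplying out the four-term expansions over all pairs: `f` records the term chosen for each
pair. -/
theorem card_embedding_expansion (H : SimpleGraph (Fin k)) (J : Host d) :
    (Nat.card (H ↪g J.2.1) : ℤ) = ∑ f : Pairs k → Fin 4,
      (∏ p : Pairs k, pairCoeff H p.1.1 p.1.2 (f p)) *
        (constraintCount (fun u v => ∃ p : Pairs k, f p = 2 ∧ p.1.1 = u ∧ p.1.2 = v)
          (fun u v => ∃ p : Pairs k, (f p = 0 ∧ p.1.1 = u ∧ p.1.2 = v) ∨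
            (f p = 1 ∧ p.1.2 = u ∧ p.1.1 = v)) J : ℤ) := by
  classical
  rw [card_embedding, Finset.card_filter]
  push_cast
  simp only [← Fintype.prod_boole, pair_expansion, Finset.prod_univ_sum, Fintype.piFinset_univ,
    Finset.prod_mul_distrib]
  rw [Finset.sum_comm]
  refine Finset.sum_congr rfl fun f _ => ?_
  rw [← Finset.mul_sum, constraintCount, Finset.card_filter]
  push_cast
  congr 1
  refine Finset.sum_congr rfl fun φ _ => ?_
  rw [Fintype.prod_boole]
  refine if_congr ⟨fun h => ⟨?_, ?_⟩, fun h p => ?_⟩ rfl rfl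
  · rintro _ _ ⟨p, hp, rfl, rfl⟩
    have := h p
    rwa [hp] at this
  · rintro _ _ ⟨p, ⟨hp, rfl, rfl⟩ | ⟨hp, rfl, rfl⟩⟩
    · have := h p
      rwa [hp] at this
    · have := h p
      rwa [hp] at this
  · obtain ⟨h1, h2⟩ := h
    have hcases : f p = 0 ∨ f p = 1 ∨ f p = 2 ∨ f p = 3 := by
      generalize f p = a
      fin_cases a <;> simp
    rcases hcases with hp | hp | hp | hp <;> rw [hp]
    · exact h2 _ _ ⟨p, .inl ⟨hp, rfl, rfl⟩⟩
    · exact h2 _ _ ⟨p, .inr ⟨hp, rfl, rfl⟩⟩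
    · exact h1 _ _ ⟨p, hp, rfl, rfl⟩
    · trivial

theorem expressible_indCount (hk : k ≤ 9) (H : SimpleGraph (Fin k)) :
    Expressible 3 fun (J : Host d) (_ : ℕ → ℕ) => indCount H J.2.1 := by
  obtain ⟨P, Q, hP, hQ, h⟩ : ExpressibleInt 3 fun J : Host d => (Nat.card (H ↪g J.2.1) : ℤ) := by
    simp only [card_embedding_expansion]
    exact .finset_sum _ fun f => (expressible_constraintCount (by simpa using hk) _ _).const_mul_int _
  have hfin : Finite (H ≃g H) := DFunLike.finite _
  have hpos : 0 < Nat.card (H ≃g H) := Nat.card_pos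
  refine ((hP.sub hQ).div (.const (Nat.card (H ≃g H)))).congr fun J _ => ?_
  have h1 := h J
  have h2 := indCount_mul_card_aut H J.2.1
  -- The machine subtracts with truncation, which is exact here because the integer difference is a
  -- cardinality.
  have h3 : P J - Q J = Nat.card (H ↪g J.2.1) := by lia
  rw [h3, ← h2, Nat.mul_div_cancel _ hpos]

end RAM

theorem mainTheorem7 :
    -- every DAG on at most nine vertices has DAG treedepth at most three
    (∀ (m : ℕ) (D : Digraph (Fin m)), m ≤ 9 → D.IsDAG → D.dagTreedepth ≤ 3) ∧
    -- for constant `d`, every pattern `H` on at most nine vertices has a program that uses a fixed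
    -- number `r` of registers, each holding a word of `O(log n)` bits, and that outputs in
    -- register `o` the number of induced copies of `H` within `O(n ^ 3)` steps
    (∀ (d k : ℕ) (H : SimpleGraph (Fin k)), k ≤ 9 →
      ∃ (r : ℕ) (P : RAM.Prog (Fin r)) (o : Fin r) (C w : ℕ),
        ∀ (n : ℕ) (G : SimpleGraph (Fin n)), G.IsDegenerate d →
          Nonempty (HostInput G d) ∧
          ∀ I : HostInput G d, ∃ (t : ℕ) (τ : Fin r → ℕ),
            RAM.Exec I (C * (n + 1) ^ w) P (fun _ => 0) t τ ∧
            t ≤ C * (n ^ 3 + 1) ∧ τ o = indCount H G) := by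
  refine ⟨fun m D hm hD => hD.dagTreedepth_le_three (by simpa using hm), fun d k H hk => ?_⟩
  obtain ⟨e, he, hval⟩ := RAM.expressible_indCount (d := d) hk H
  obtain ⟨r, P, o, C, w, h⟩ := e.exists_prog d he
  refine ⟨r, P, o, C, w, fun n G hG => ⟨hG.nonempty_hostInput, fun I => ?_⟩⟩
  obtain ⟨t, τ, hE, ht, hτ⟩ := h n G I
  exact ⟨t, τ, hE, ht, hτ.trans (hval ⟨n, G, I⟩ _)⟩
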